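/- Let $p$ be a prime and $R$ a commutative ring with $1$. For finite groups $H,G$, a finite $(H,G)$-biset is called $p$-bifree if the stabilizers in $H$ and in $G$ of all of its elements have order prime to $p$; let $B^\Delta(H,G)$ be the Grothendieck group, with respect to disjoint union, of finite $p$-bifree $(H,G)$-bisets, and $RB^\Delta(H,G)=R\otimes_{\mathbb Z}B^\Delta(H,G)$. Let $R\mathcal C^\Delta$ be the category whose objects are the finite groups, with $\mathrm{Hom}(G,H)=RB^\Delta(H,G)$, with composition induced by $(Y,X)\mapsto Y\times_H X$, and with identities $[G]$. A $p$-bifree biset functor over $R$ is an $R$-linear functor $R\mathcal C^\Delta\to R\text{-Mod}$; these form a category $\mathcal F^\Delta_R$ with natural transformations as morphisms. For a finite group $G$ let $E_G=RB^\Delta(G,G)=\mathrm{End}_{R\mathcal C^\Delta}(G)$, let $I_G=\sum_{|H|<|G|}RB^\Delta(G,H)\circ RB^\Delta(H,G)$, an ideal of $E_G$, and let $\mathcal E^\Delta(G)=E_G/I_G$. Let $\mathrm{Out}(G)=\mathrm{Aut}(G)/\mathrm{Inn}(G)$. (1) For every finite group $G$ there is an isomorphism of $R$-algebras $\mathcal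 E^\Delta(G)\cong R\,\mathrm{Out}(G)$ which, for every $a\in\mathrm{Aut}(G)$, maps the class of the $(G,G)$-biset $G$ with actions $g\cdot x\cdot g'=g\,x\,a(g')$ to the class of $a$ in $\mathrm{Out}(G)$. By means of the isomorphism in (1), regard every $R\,\mathrm{Out}(G)$-module $V$ as an $E_G$-module. Put $L_{G,V}(H)=RB^\Delta(H,G)\otimes_{E_G}V$, let $$J_{G,V}(H)=\Bigl\{\textstyle\sum_i x_i\otimes v_i\in L_{G,V}(H)\ \Big|\ \sum_i (y\circ x_i)v_i=0\ \text{ for all } y\in RB^\Delta(G,H)\Bigr\},$$ and let $S^\Delta_{G,V}=L_{G,V}/J_{G,V}$, which is a $p$-bifree biset functor over $R$. (2) If $G$ is a finite group and $V$ is a simple $R\,\mathrm{Out}(G)$-module, then $S^\Delta_{G,V}$ is a simple object of $\mathcal F^\Delta_R$. (3) Every simple object of $\mathcal F^\Delta_R$ is isomorphic to $S^\Delta_{G,V}$ for some finite group $G$ and some simple $R\,\mathrm{Out}(G)$-module $V$. (4) For finite groups $G,H$, a simple $R\,\mathrm{Out}(G)$-module $V$ and a simple $R\,\mathrm{Out}(H)$-module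 $W$, one has $S^\Delta_{G,V}\cong S^\Delta_{H,W}$ if and only if there are a group isomorphism $f:G\to H$ and an $R$-linear isomorphism $t:V\to W$ such that $t(\alpha v)=f_*(\alpha)\,t(v)$ for all $\alpha\in R\,\mathrm{Out}(G)$ and $v\in V$, where $f_*:R\,\mathrm{Out}(G)\to R\,\mathrm{Out}(H)$ is the algebra isomorphism induced by $a\mapsto f\circ a\circ f^{-1}$. -/

import Mathlib

open CategoryTheory MulOpposite
open scoped TensorProduct

universe u w

namespace PBifree

/-! ### Finite `p`-bifree bisets -/

/-- A finite `p`-bifree `(H, G)`-biset: a finite set with commuting left `H`-action and right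
`G`-action (i.e. left `Gᵐᵒᵖ`-action) such that all the stabilizers in `H` and all the stabilizers
in `G` are `p'`-groups. -/
structure Biset (p : ℕ) (H G : Type u) [Group H] [Group G] : Type (u + 1) where
  carrier : Type u
  [finite : Finite carrier]
  [left : MulAction H carrier]
  [right : MulAction Gᵐᵒᵖ carrier]
  [comm : SMulCommClass H Gᵐᵒᵖ carrier]
  left_stab : ∀ x : carrier, ¬ p ∣ Nat.card (MulAction.stabilizer H x)
  right_stab : ∀ x : carrier, ¬ p ∣ Nat.card (MulAction.stabilizer Gᵐᵒᵖ x)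

attribute [instance] Biset.finite Biset.left Biset.right Biset.comm

/-- Isomorphisms of bisets: bijections commuting with both actions. -/
structure Biset.Iso {p : ℕ} {H G : Type u} [Group H] [Group G] (X Y : Biset p H G) extends
    X.carrier ≃ Y.carrier where
  map_left : ∀ (h : H) (x : X.carrier), toFun (h • x) = h • toFun x
  map_right : ∀ (g : G) (x : X.carrier), toFun (op g • x) = op g • toFun x

section Groups

variable {p : ℕ} {K H G : Type u} [Group K] [Group H] [Group G]

namespace Biset

instance isoSetoid (p : ℕ) (H G : Type u) [Group H] [Group G] : Setoid (Biset p H G) where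
  r X Y := Nonempty (Iso X Y)
  iseqv :=
    { refl := fun X => ⟨⟨Equiv.refl _, fun _ _ => rfl, fun _ _ => rfl⟩⟩
      symm := by
        rintro X Y ⟨f⟩
        refine ⟨⟨f.toEquiv.symm, fun h y => ?_, fun g y => ?_⟩⟩
        · apply f.toEquiv.injective
          have := f.map_left h (f.toEquiv.symm y)
          simp_all
        · apply f.toEquiv.injective
          have := f.map_right g (f.toEquiv.symm y)
          simp_all
      trans := by
        rintro X Y Z ⟨f⟩ ⟨g⟩
        refine ⟨⟨f.toEquiv.trans g.toEquiv, fun h x => ?_, fun h x => ?_⟩⟩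
        · exact (congrArg g.toFun (f.map_left h x)).trans (g.map_left h _)
        · exact (congrArg g.toFun (f.map_right h x)).trans (g.map_right h _) }

/-- The empty biset. -/
def empty (p : ℕ) (H G : Type u) [Group H] [Group G] : Biset p H G :=
  letI : MulAction H PEmpty.{u + 1} :=
    { smul := fun _ x => x, one_smul := fun _ => rfl, mul_smul := fun _ _ _ => rfl }
  letI : MulAction Gᵐᵒᵖ PEmpty.{u + 1} :=
    { smul := fun _ x => x, one_smul := fun _ => rfl, mul_smul := fun _ _ _ => rfl }
  { carrier := PEmpty.{u + 1}
    comm := ⟨fun _ _ x => x.elim⟩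
    left_stab := fun x => x.elim
    right_stab := fun x => x.elim }

/-- The disjoint union of two bisets. -/
def sum (X Y : Biset p H G) : Biset p H G where
  carrier := X.carrier ⊕ Y.carrier
  left_stab := by
    rintro (x | x)
    · rw [show MulAction.stabilizer H (Sum.inl x : X.carrier ⊕ Y.carrier)
        = MulAction.stabilizer H x by ext; simp [MulAction.mem_stabilizer_iff]]
      exact X.left_stab x
    · rw [show MulAction.stabilizer H (Sum.inr x : X.carrier ⊕ Y.carrier)
        = MulAction.stabilizer H x by ext; simp [MulAction.mem_stabilizer_iff]]
      exact Y.left_stab x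
  right_stab := by
    rintro (x | x)
    · rw [show MulAction.stabilizer Gᵐᵒᵖ (Sum.inl x : X.carrier ⊕ Y.carrier)
        = MulAction.stabilizer Gᵐᵒᵖ x by ext; simp [MulAction.mem_stabilizer_iff]]
      exact X.right_stab x
    · rw [show MulAction.stabilizer Gᵐᵒᵖ (Sum.inr x : X.carrier ⊕ Y.carrier)
        = MulAction.stabilizer Gᵐᵒᵖ x by ext; simp [MulAction.mem_stabilizer_iff]]
      exact Y.right_stab x

/-- The `(H, G)`-biset attached to a group isomorphism `f : G ≃* H`: the set `H`, with `H` acting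
by left multiplication and `G` acting on the right by `x · g = x * f g`. -/
def ofIso (p : ℕ) [Fact p.Prime] [Finite H] (f : G ≃* H) : Biset p H G :=
  letI : MulAction Gᵐᵒᵖ H :=
    { smul := fun g x => x * f g.unop
      one_smul := fun x => by change x * f 1 = x; simp
      mul_smul := fun a b x => by
        change x * f (b.unop * a.unop) = x * f b.unop * f a.unop
        simp [mul_assoc] }
  { carrier := H
    comm := ⟨fun a b x => (mul_assoc a x (f b.unop)).symm⟩
    left_stab := fun x => by
      have h : MulAction.stabilizer H x = ⊥ := by
        ext a; simp
      rw [h, Subgroup.card_bot]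
      exact (Fact.out : p.Prime).one_lt.ne' ∘ Nat.dvd_one.mp
    right_stab := fun x => by
      have h : MulAction.stabilizer Gᵐᵒᵖ x = ⊥ := by
        ext a
        rw [MulAction.mem_stabilizer_iff, Subgroup.mem_bot]
        change x * f a.unop = x ↔ _
        simp
      rw [h, Subgroup.card_bot]
      exact (Fact.out : p.Prime).one_lt.ne' ∘ Nat.dvd_one.mp }

/-- The equivalence relation on `Y × X` identifying `(y · h, x)` with `(y, h · x)`. -/
def compSetoid (Y : Biset p K H) (X : Biset p H G) : Setoid (Y.carrier × X.carrier) where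
  r a b := ∃ h : H, a.1 = op h • b.1 ∧ h • a.2 = b.2
  iseqv :=
    { refl := fun a => ⟨1, by simp⟩
      symm := by
        rintro ⟨y, x⟩ ⟨y', x'⟩ ⟨h, h1, h2⟩
        refine ⟨h⁻¹, ?_, ?_⟩
        · simp_all
        · exact inv_smul_eq_iff.mpr h2.symm
      trans := by
        rintro ⟨y, x⟩ ⟨y', x'⟩ ⟨y'', x''⟩ ⟨h, h1, h2⟩ ⟨k, k1, k2⟩
        refine ⟨k * h, ?_, ?_⟩
        · simp_all [mul_smul]
        · simp_all [mul_smul] }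

theorem orderOf_ne_of_smul_eq {A B Y : Type*} [Group A] [Group B] [MulAction A Y] [MulAction B Y]
    [SMulCommClass A B Y] {p m : ℕ} (hp : p.Prime) {a : A} {b : B} {y : Y} (hab : a • y = b • y)
    (hb : b ^ m = 1) (hm : ¬ p ∣ m) (hy : ¬ p ∣ Nat.card (MulAction.stabilizer A y)) :
    orderOf a ≠ p := by
  intro ha
  have key : ∀ n : ℕ, a ^ n • y = b ^ n • y := by
    intro n
    induction n with
    | zero => simp
    | succ n ih => rw [pow_succ, mul_smul, hab, smul_comm, ih, ← mul_smul, ← pow_succ']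
  have hmem : a ^ m ∈ MulAction.stabilizer A y := by
    rw [MulAction.mem_stabilizer_iff, key m, hb, one_smul]
  have h1 : (⟨a ^ m, hmem⟩ : MulAction.stabilizer A y) ^ Nat.card (MulAction.stabilizer A y) = 1 :=
    pow_card_eq_one'
  have h2 : a ^ (m * Nat.card (MulAction.stabilizer A y)) = 1 := by
    have := congrArg Subtype.val h1
    rw [pow_mul]
    simpa using this
  have h3 := orderOf_dvd_of_pow_eq_one h2
  rw [ha] at h3
  rcases hp.dvd_mul.mp h3 with h | h
  · exact hm h
  · exact hy h

/-- The composition `Y ×_H X` of a `(K, H)`-biset `Y` and an `(H, G)`-biset `X`. -/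
def comp [Fact p.Prime] [Finite K] [Finite G] (Y : Biset p K H) (X : Biset p H G) :
    Biset p K G :=
  letI : MulAction K (Quotient (compSetoid Y X)) :=
    { smul := fun k => Quotient.map (fun a => (k • a.1, a.2)) (by
        rintro a b ⟨h, h1, h2⟩
        exact ⟨h, by simp [h1, smul_comm], h2⟩)
      one_smul := by
        rintro ⟨a⟩
        exact congrArg (Quotient.mk _) (Prod.ext (one_smul K a.1) rfl)
      mul_smul := by
        rintro k l ⟨a⟩
        exact congrArg (Quotient.mk _) (Prod.ext (mul_smul k l a.1) rfl) }
  letI : MulAction Gᵐᵒᵖ (Quotient (compSetoid Y X)) :=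
    { smul := fun g => Quotient.map (fun a => (a.1, g • a.2)) (by
        rintro a b ⟨h, h1, h2⟩
        exact ⟨h, h1, by simp [← h2, smul_comm]⟩)
      one_smul := by
        rintro ⟨a⟩
        exact congrArg (Quotient.mk _) (Prod.ext rfl (one_smul Gᵐᵒᵖ a.2))
      mul_smul := by
        rintro k l ⟨a⟩
        exact congrArg (Quotient.mk _) (Prod.ext rfl (mul_smul k l a.2)) }
  { carrier := Quotient (compSetoid Y X)
    comm := ⟨by rintro k g ⟨a⟩; rfl⟩
    left_stab := by
      rintro ⟨y, x⟩ hdvd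
      obtain ⟨⟨k, hk⟩, hord⟩ := exists_prime_orderOf_dvd_card' p hdvd
      rw [Subgroup.orderOf_mk] at hord
      obtain ⟨h, h1, h2⟩ := Quotient.exact (MulAction.mem_stabilizer_iff.mp hk)
      have h3 : (⟨h, h2⟩ : MulAction.stabilizer H x) ^ Nat.card (MulAction.stabilizer H x) = 1 :=
        pow_card_eq_one'
      refine orderOf_ne_of_smul_eq (b := op h) Fact.out h1 ?_ (X.left_stab x) (Y.left_stab y) hord
      rw [← op_pow, op_eq_one_iff]
      simpa using congrArg Subtype.val h3
    right_stab := by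
      rintro ⟨y, x⟩ hdvd
      have : Finite Gᵐᵒᵖ := Finite.of_equiv G opEquiv
      have : SMulCommClass Gᵐᵒᵖ H X.carrier := SMulCommClass.symm _ _ _
      obtain ⟨⟨g, hg⟩, hord⟩ := exists_prime_orderOf_dvd_card' p hdvd
      rw [Subgroup.orderOf_mk] at hord
      obtain ⟨h, h1, h2⟩ := Quotient.exact (MulAction.mem_stabilizer_iff.mp hg)
      have h3 : (⟨op h, h1.symm⟩ : MulAction.stabilizer Hᵐᵒᵖ y) ^
          Nat.card (MulAction.stabilizer Hᵐᵒᵖ y) = 1 := pow_card_eq_one'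
      refine orderOf_ne_of_smul_eq (b := h⁻¹) Fact.out (eq_inv_smul_iff.mpr h2) ?_
        (Y.right_stab y) (X.right_stab x) hord
      rw [inv_pow, inv_eq_one, ← op_eq_one_iff, op_pow]
      simpa using congrArg Subtype.val h3 }

/-! The compatibilities of disjoint union and composition with isomorphisms. -/

theorem sum_congr {X X' Y Y' : Biset p H G} (hX : X ≈ X') (hY : Y ≈ Y') :
    X.sum Y ≈ X'.sum Y' := by
  obtain ⟨f⟩ := hX
  obtain ⟨g⟩ := hY
  refine ⟨⟨Equiv.sumCongr f.toEquiv g.toEquiv, ?_, ?_⟩⟩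
  · rintro h (x | x)
    · exact congrArg Sum.inl (f.map_left h x)
    · exact congrArg Sum.inr (g.map_left h x)
  · rintro h (x | x)
    · exact congrArg Sum.inl (f.map_right h x)
    · exact congrArg Sum.inr (g.map_right h x)

theorem sum_assoc (X Y Z : Biset p H G) : (X.sum Y).sum Z ≈ X.sum (Y.sum Z) :=
  ⟨⟨Equiv.sumAssoc _ _ _, by rintro h ((x | x) | x) <;> rfl,
    by rintro h ((x | x) | x) <;> rfl⟩⟩

theorem sum_comm (X Y : Biset p H G) : X.sum Y ≈ Y.sum X :=
  ⟨⟨Equiv.sumComm _ _, by rintro h (x | x) <;> rfl, by rintro h (x | x) <;> rfl⟩⟩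

theorem empty_sum (X : Biset p H G) : (empty p H G).sum X ≈ X :=
  ⟨⟨Equiv.emptySum PEmpty _, by rintro h (x | x); exacts [x.elim, rfl],
    by rintro h (x | x); exacts [x.elim, rfl]⟩⟩

variable [Fact p.Prime] [Finite K] [Finite G]

theorem comp_congr {Y Y' : Biset p K H} {X X' : Biset p H G} (hY : Y ≈ Y') (hX : X ≈ X') :
    Y.comp X ≈ Y'.comp X' := by
  obtain ⟨g⟩ := hY
  obtain ⟨f⟩ := hX
  refine ⟨⟨Quotient.congr (Equiv.prodCongr g.toEquiv f.toEquiv) ?_, ?_, ?_⟩⟩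
  · rintro ⟨y, x⟩ ⟨y', x'⟩
    have e1 : ∀ h : H, y = op h • y' ↔ g.toEquiv y = op h • g.toEquiv y' := fun h => by
      rw [← g.toEquiv.injective.eq_iff]
      exact Eq.congr_right (g.map_right h y')
    have e2 : ∀ h : H, h • x = x' ↔ h • f.toEquiv x = f.toEquiv x' := fun h => by
      rw [← f.toEquiv.injective.eq_iff]
      exact Eq.congr_left (f.map_left h x)
    exact exists_congr fun h => and_congr (e1 h) (e2 h)
  · rintro k ⟨y, x⟩
    exact congrArg (Quotient.mk _) (Prod.ext (g.map_left k y) rfl)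
  · rintro k ⟨y, x⟩
    exact congrArg (Quotient.mk _) (Prod.ext rfl (f.map_right k x))

theorem empty_comp (X : Biset p H G) : (empty p K H).comp X ≈ empty p K G :=
  haveI : IsEmpty ((empty p K H).comp X).carrier := ⟨by rintro ⟨y, x⟩; exact PEmpty.elim y⟩
  haveI : IsEmpty (empty p K G).carrier := inferInstanceAs (IsEmpty PEmpty)
  ⟨⟨Equiv.equivOfIsEmpty _ _, fun _ x => isEmptyElim x, fun _ x => isEmptyElim x⟩⟩

theorem comp_empty (Y : Biset p K H) : Y.comp (empty p H G) ≈ empty p K G :=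
  haveI : IsEmpty (Y.comp (empty p H G)).carrier := ⟨by rintro ⟨y, x⟩; exact PEmpty.elim x⟩
  haveI : IsEmpty (empty p K G).carrier := inferInstanceAs (IsEmpty PEmpty)
  ⟨⟨Equiv.equivOfIsEmpty _ _, fun _ x => isEmptyElim x, fun _ x => isEmptyElim x⟩⟩

theorem sum_comp (Y Y' : Biset p K H) (X : Biset p H G) :
    (Y.sum Y').comp X ≈ (Y.comp X).sum (Y'.comp X) := by
  refine ⟨⟨⟨?_, ?_, ?_, ?_⟩, ?_, ?_⟩⟩
  · refine Quotient.lift (fun a => Sum.elim (fun y => Sum.inl (Quotient.mk _ (y, a.2)))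
      (fun y => Sum.inr (Quotient.mk _ (y, a.2))) a.1) ?_
    rintro ⟨y | y, x⟩ ⟨y' | y', x'⟩ ⟨h, h1, h2⟩
    · exact congrArg Sum.inl (Quotient.sound ⟨h, Sum.inl_injective h1, h2⟩)
    · exact (Sum.inl_ne_inr h1).elim
    · exact (Sum.inr_ne_inl h1).elim
    · exact congrArg Sum.inr (Quotient.sound ⟨h, Sum.inr_injective h1, h2⟩)
  · refine Sum.elim (Quotient.map (fun a => (Sum.inl a.1, a.2)) ?_)
      (Quotient.map (fun a => (Sum.inr a.1, a.2)) ?_)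
    · rintro a b ⟨h, h1, h2⟩
      exact ⟨h, congrArg Sum.inl h1, h2⟩
    · rintro a b ⟨h, h1, h2⟩
      exact ⟨h, congrArg Sum.inr h1, h2⟩
  · rintro ⟨y | y, x⟩ <;> rfl
  · rintro (⟨y, x⟩ | ⟨y, x⟩) <;> rfl
  · rintro h ⟨y | y, x⟩ <;> rfl
  · rintro h ⟨y | y, x⟩ <;> rfl

theorem comp_sum (Y : Biset p K H) (X X' : Biset p H G) :
    Y.comp (X.sum X') ≈ (Y.comp X).sum (Y.comp X') := by
  refine ⟨⟨⟨?_, ?_, ?_, ?_⟩, ?_, ?_⟩⟩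
  · refine Quotient.lift (fun a => Sum.elim (fun x => Sum.inl (Quotient.mk _ (a.1, x)))
      (fun x => Sum.inr (Quotient.mk _ (a.1, x))) a.2) ?_
    rintro ⟨y, x | x⟩ ⟨y', x' | x'⟩ ⟨h, h1, h2⟩
    · exact congrArg Sum.inl (Quotient.sound ⟨h, h1, Sum.inl_injective h2⟩)
    · exact (Sum.inl_ne_inr h2).elim
    · exact (Sum.inr_ne_inl h2).elim
    · exact congrArg Sum.inr (Quotient.sound ⟨h, h1, Sum.inr_injective h2⟩)
  · refine Sum.elim (Quotient.map (fun a => (a.1, Sum.inl a.2)) ?_)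
      (Quotient.map (fun a => (a.1, Sum.inr a.2)) ?_)
    · rintro a b ⟨h, h1, h2⟩
      exact ⟨h, h1, congrArg Sum.inl h2⟩
    · rintro a b ⟨h, h1, h2⟩
      exact ⟨h, h1, congrArg Sum.inr h2⟩
  · rintro ⟨y, x | x⟩ <;> rfl
  · rintro (⟨y, x⟩ | ⟨y, x⟩) <;> rfl
  · rintro h ⟨y, x | x⟩ <;> rfl
  · rintro h ⟨y, x | x⟩ <;> rfl

variable [Finite H]

theorem comp_assoc {L : Type u} [Group L] [Finite L] (Z : Biset p L K) (Y : Biset p K H)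
    (X : Biset p H G) : (Z.comp Y).comp X ≈ Z.comp (Y.comp X) := by
  refine ⟨⟨⟨?_, ?_, ?_, ?_⟩, ?_, ?_⟩⟩
  · refine Quotient.lift (fun a => Quotient.lift
      (fun b : Z.carrier × Y.carrier => Quotient.mk (compSetoid Z (Y.comp X))
        (b.1, Quotient.mk (compSetoid Y X) (b.2, a.2))) ?_ a.1) ?_
    · rintro ⟨z, y⟩ ⟨z', y'⟩ ⟨k, h1, h2⟩
      exact Quotient.sound ⟨k, h1, congrArg (Quotient.mk _) (Prod.ext h2 rfl)⟩
    · rintro ⟨⟨z, y⟩, x⟩ ⟨⟨z', y'⟩, x'⟩ ⟨h, h1, h2⟩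
      obtain ⟨k, h3, h4⟩ := Quotient.exact h1
      refine Quotient.sound ⟨k, h3, Quotient.sound ⟨h, h4, h2⟩⟩
  · refine Quotient.lift (fun a => Quotient.lift
      (fun b : Y.carrier × X.carrier => Quotient.mk (compSetoid (Z.comp Y) X)
        (Quotient.mk (compSetoid Z Y) (a.1, b.1), b.2)) ?_ a.2) ?_
    · rintro ⟨y, x⟩ ⟨y', x'⟩ ⟨h, h1, h2⟩
      exact Quotient.sound ⟨h, congrArg (Quotient.mk _) (Prod.ext rfl h1), h2⟩
    · rintro ⟨z, ⟨y, x⟩⟩ ⟨z', ⟨y', x'⟩⟩ ⟨k, h1, h2⟩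
      obtain ⟨h, h3, h4⟩ := Quotient.exact h2
      refine Quotient.sound ⟨h, Quotient.sound ⟨k, h1, h3⟩, h4⟩
  · rintro ⟨⟨z, y⟩, x⟩; rfl
  · rintro ⟨z, ⟨y, x⟩⟩; rfl
  · rintro l ⟨⟨z, y⟩, x⟩; rfl
  · rintro l ⟨⟨z, y⟩, x⟩; rfl

theorem ofIso_refl_comp (X : Biset p H G) : (ofIso p (MulEquiv.refl H)).comp X ≈ X := by
  refine ⟨⟨⟨?_, ?_, ?_, ?_⟩, ?_, ?_⟩⟩
  · refine Quotient.lift (fun a : H × X.carrier => a.1 • a.2) ?_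
    rintro ⟨a, x⟩ ⟨b, x'⟩ ⟨h, h1, h2⟩
    change a = HMul.hMul (α := H) (β := H) b h at h1
    change h • x = x' at h2
    change HSMul.hSMul (α := H) a x = HSMul.hSMul (α := H) b x'
    rw [h1, ← h2]
    exact mul_smul (α := H) b h x
  · exact fun x => Quotient.mk _ ((1 : H), x)
  · rintro ⟨a, x⟩
    exact Quotient.sound ⟨a⁻¹, (mul_inv_cancel (G := H) a).symm, inv_smul_smul (G := H) a x⟩
  · exact fun x => one_smul H x
  · rintro h ⟨a, x⟩
    exact mul_smul (α := H) h a x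
  · rintro g ⟨a, x⟩
    exact smul_comm (M := H) a (op g) x

theorem comp_ofIso_refl (X : Biset p H G) : X.comp (ofIso p (MulEquiv.refl G)) ≈ X := by
  refine ⟨⟨⟨?_, ?_, ?_, ?_⟩, ?_, ?_⟩⟩
  · refine Quotient.lift (fun a : X.carrier × G => op a.2 • a.1) ?_
    rintro ⟨x, a⟩ ⟨x', b⟩ ⟨h, h1, h2⟩
    change x = op h • x' at h1
    change HMul.hMul (α := G) (β := G) h a = b at h2
    change op (α := G) a • x = op (α := G) b • x'
    rw [h1, ← h2, ← mul_smul]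
    rfl
  · exact fun x => Quotient.mk _ (x, (1 : G))
  · rintro ⟨x, a⟩
    refine Quotient.sound ⟨a, rfl, mul_one (M := G) a⟩
  · exact fun x => one_smul Gᵐᵒᵖ x
  · rintro h ⟨x, a⟩
    exact (smul_comm h (op (show G from a)) x).symm
  · rintro g ⟨x, a⟩
    exact mul_smul (op g) (op (show G from a)) x

end Biset

/-! ### The Grothendieck group `B^Δ(H, G)` and `R B^Δ(H, G)` -/

variable (p H G) in
/-- The set of isomorphism classes of finite `p`-bifree `(H, G)`-bisets. -/
def BisetClass : Type (u + 1) := Quotient (Biset.isoSetoid p H G)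

/-- The class of isomorphism of a biset. -/
def BisetClass.mk (X : Biset p H G) : BisetClass p H G := Quotient.mk _ X

/-- Isomorphism classes of bisets form a commutative monoid under disjoint union. -/
instance : AddCommMonoid (BisetClass p H G) :=
  letI : Zero (BisetClass p H G) := ⟨.mk (.empty p H G)⟩
  letI : Add (BisetClass p H G) :=
    ⟨Quotient.map₂ Biset.sum fun _ _ h _ _ h' => Biset.sum_congr h h'⟩
  { nsmul := nsmulRec
    add_assoc := by rintro ⟨X⟩ ⟨Y⟩ ⟨Z⟩; exact Quotient.sound (Biset.sum_assoc X Y Z)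
    add_comm := by rintro ⟨X⟩ ⟨Y⟩; exact Quotient.sound (Biset.sum_comm X Y)
    zero_add := by rintro ⟨X⟩; exact Quotient.sound (Biset.empty_sum X)
    add_zero := by
      rintro ⟨X⟩
      exact Quotient.sound (Setoid.trans (Biset.sum_comm X _) (Biset.empty_sum X)) }

/-- The biadditive composition on isomorphism classes. -/
def BisetClass.comp [Fact p.Prime] [Finite K] [Finite H] [Finite G] :
    BisetClass p K H →+ BisetClass p H G →+ BisetClass p K G where
  toFun y :=
    { toFun := fun x => Quotient.map₂ Biset.comp (fun _ _ h _ _ h' => Biset.comp_congr h h') y x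
      map_zero' := by
        obtain ⟨Y⟩ := y
        exact Quotient.sound (Biset.comp_empty Y)
      map_add' := by
        obtain ⟨Y⟩ := y
        rintro ⟨X⟩ ⟨X'⟩
        exact Quotient.sound (Biset.comp_sum Y X X') }
  map_zero' := by
    ext ⟨X⟩
    exact Quotient.sound (Biset.empty_comp X)
  map_add' := by
    rintro ⟨Y⟩ ⟨Y'⟩
    ext ⟨X⟩
    exact Quotient.sound (Biset.sum_comp Y Y' X)

variable (p H G) in
/-- The Grothendieck group `B^Δ(H, G)` of finite `p`-bifree `(H, G)`-bisets. -/
abbrev BurnsideGroup : Type (u + 1) := Algebra.GrothendieckAddGroup (BisetClass p H G)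

namespace BurnsideGroup

/-- The class of a biset in `B^Δ(H, G)`. -/
def mk (X : Biset p H G) : BurnsideGroup p H G := Algebra.GrothendieckAddGroup.of (.mk X)

theorem hom_ext {A : Type*} [AddCommGroup A] {f g : BurnsideGroup p H G →+ A}
    (h : ∀ X : Biset p H G, f (mk X) = g (mk X)) : f = g := by
  apply Algebra.GrothendieckAddGroup.lift.symm.injective
  ext ⟨X⟩
  exact h X

theorem lift_mk {A : Type*} [AddCommGroup A] (f : BisetClass p H G →+ A) (X : Biset p H G) :
    Algebra.GrothendieckAddGroup.lift f (mk X) = f (.mk X) :=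
  DFunLike.congr_fun (Algebra.GrothendieckAddGroup.lift.symm_apply_apply f) (BisetClass.mk X)

variable [Fact p.Prime] [Finite K] [Finite H] [Finite G]

/-- The biadditive composition `B^Δ(K, H) × B^Δ(H, G) → B^Δ(K, G)`. -/
noncomputable def comp :
    BurnsideGroup p K H →+ BurnsideGroup p H G →+ BurnsideGroup p K G :=
  Algebra.GrothendieckAddGroup.lift
    { toFun := fun y => Algebra.GrothendieckAddGroup.lift
        (Algebra.GrothendieckAddGroup.of.comp (BisetClass.comp y))
      map_zero' := hom_ext fun X => by simp [lift_mk]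
      map_add' := fun y y' => hom_ext fun X => by simp [lift_mk] }

theorem comp_mk (Y : Biset p K H) (X : Biset p H G) : comp (mk Y) (mk X) = mk (Y.comp X) := by
  rw [comp, lift_mk]
  exact lift_mk _ X

end BurnsideGroup

variable (R : Type w) [CommRing R]

variable (p H G) in
/-- `R B^Δ(H, G) = R ⊗_ℤ B^Δ(H, G)`. -/
abbrev RB : Type (max (u + 1) w) := R ⊗[ℤ] BurnsideGroup p H G

namespace RB

/-- The class of a biset in `R B^Δ(H, G)`. -/
noncomputable def mk (X : Biset p H G) : RB p H G R := 1 ⊗ₜ BurnsideGroup.mk X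

variable {R} in
theorem hom_ext {A : Type*} [AddCommGroup A] [Module R A] {f g : RB p H G R →ₗ[R] A}
    (h : ∀ X : Biset p H G, f (mk R X) = g (mk R X)) : f = g := by
  have key : (f.toAddMonoidHom.comp
      (TensorProduct.mk ℤ R (BurnsideGroup p H G) 1).toAddMonoidHom) =
      (g.toAddMonoidHom.comp (TensorProduct.mk ℤ R (BurnsideGroup p H G) 1).toAddMonoidHom) :=
    BurnsideGroup.hom_ext h
  ext b
  exact DFunLike.congr_fun key b

theorem mk_eq {X Y : Biset p H G} (h : X ≈ Y) : mk R X = mk R Y := by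
  have : BisetClass.mk X = BisetClass.mk Y := Quotient.sound h
  rw [mk, mk, BurnsideGroup.mk, BurnsideGroup.mk, this]

variable [Fact p.Prime] [Finite K] [Finite H] [Finite G]

/-- The `R`-bilinear composition `R B^Δ(K, H) × R B^Δ(H, G) → R B^Δ(K, G)`. -/
noncomputable def comp : RB p K H R →ₗ[R] RB p H G R →ₗ[R] RB p K G R :=
  LinearMap.liftBaseChange R
    (AddMonoidHom.toIntLinearMap
      { toFun := fun b => (BurnsideGroup.comp b).toIntLinearMap.baseChange R
        map_zero' := hom_ext fun X => by simp [mk]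
        map_add' := fun b b' => hom_ext fun X => by simp [mk, TensorProduct.tmul_add] })

theorem comp_mk (Y : Biset p K H) (X : Biset p H G) :
    comp R (mk R Y) (mk R X) = mk R (Y.comp X) := by
  simp [comp, mk, BurnsideGroup.comp_mk]

theorem comp_assoc {L : Type u} [Group L] [Finite L] (z : RB p L K R) (y : RB p K H R)
    (x : RB p H G R) : comp R (comp R z y) x = comp R z (comp R y x) := by
  have h₁ : ∀ (Z : Biset p L K) (Y : Biset p K H),
      comp R (comp R (mk R Z) (mk R Y)) =
        (comp R (mk R Z)) ∘ₗ (comp R (mk R Y) : RB p H G R →ₗ[R] _) := fun Z Y =>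
    hom_ext fun X => by
      simp only [LinearMap.comp_apply, comp_mk]
      exact mk_eq R (Biset.comp_assoc Z Y X)
  have h₂ : ∀ Z : Biset p L K,
      (comp R).flip x ∘ₗ (comp R (mk R Z) : RB p K H R →ₗ[R] _) =
        comp R (mk R Z) ∘ₗ (comp R).flip x := fun Z =>
    hom_ext fun Y => by
      simpa using DFunLike.congr_fun (h₁ Z Y) x
  have h₃ : (comp R).flip x ∘ₗ (comp R).flip y =
      (comp R (p := p) (K := L)).flip (comp R y x) :=
    hom_ext fun Z => by
      simpa using DFunLike.congr_fun (h₂ Z) y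
  simpa using DFunLike.congr_fun h₃ z

theorem id_comp (x : RB p H G R) : comp R (mk R (.ofIso p (MulEquiv.refl H))) x = x := by
  have h : comp R (mk R (.ofIso p (MulEquiv.refl H))) = (LinearMap.id : RB p H G R →ₗ[R] _) :=
    hom_ext fun X => by
      rw [comp_mk, LinearMap.id_apply]
      exact mk_eq R (Biset.ofIso_refl_comp X)
  rw [h, LinearMap.id_apply]

theorem comp_id (x : RB p H G R) : comp R x (mk R (.ofIso p (MulEquiv.refl G))) = x := by
  have h : (comp R).flip (mk R (.ofIso p (MulEquiv.refl G))) =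
      (LinearMap.id : RB p H G R →ₗ[R] _) :=
    hom_ext fun X => by
      rw [LinearMap.flip_apply, comp_mk, LinearMap.id_apply]
      exact mk_eq R (Biset.comp_ofIso_refl X)
  rw [← LinearMap.flip_apply, h, LinearMap.id_apply]

end RB

end Groups

/-! ### The category of finite groups and `p`-bifree bisets -/

/-- The objects of the category `R C^Δ`: finite groups. -/
structure BisetCat (R : Type w) (p : ℕ) : Type (u + 1) where
  carrier : Type u
  [group : Group carrier]
  [finite : Finite carrier]

attribute [instance] BisetCat.group BisetCat.finite

section Category

variable {R : Type w} [CommRing R] {p : ℕ} [Fact p.Prime]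

/-- The category `R C^Δ`: `Hom(G, H) = R B^Δ(H, G)`, with composition `y ∘ x = y ×_H x` and the
identity of `G` being the class of the biset `G`. -/
noncomputable instance : Category.{max (u + 1) w} (BisetCat.{u, w} R p) where
  Hom G H := RB p H.carrier G.carrier R
  id G := RB.mk R (.ofIso p (MulEquiv.refl G.carrier))
  comp x y := RB.comp R y x
  id_comp x := RB.comp_id R x
  comp_id x := RB.id_comp R x
  assoc x y z := (RB.comp_assoc R z y x).symm

noncomputable instance : Preadditive (BisetCat.{u, w} R p) where
  homGroup G H := inferInstanceAs (AddCommGroup (RB p H.carrier G.carrier R))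
  add_comp _ _ _ x x' y := (RB.comp R y).map_add x x'
  comp_add _ _ _ x y y' := LinearMap.map_add₂ (RB.comp R) y y' x

noncomputable instance : Linear R (BisetCat.{u, w} R p) where
  homModule G H := inferInstanceAs (Module R (RB p H.carrier G.carrier R))
  smul_comp _ _ _ r x y := (RB.comp R y).map_smul r x
  comp_smul _ _ _ x r y := LinearMap.map_smul₂ (RB.comp R) r y x

/-- The morphism `G ⟶ H` of `R C^Δ` given by a `p`-bifree `(H, G)`-biset. -/
noncomputable def BisetCat.homOfBiset {G H : BisetCat.{u, w} R p}
    (X : Biset p H.carrier G.carrier) : G ⟶ H := RB.mk R X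

/-! ### The essential algebra and the outer automorphism group -/

/-- The ideal `I_G = ∑_{|H| < |G|} R B^Δ(G, H) ∘ R B^Δ(H, G)` of `End(G) = R B^Δ(G, G)`. -/
noncomputable def essentialIdeal (G : BisetCat.{u, w} R p) : Ideal (End G) where
  __ := (Submodule.span R {f : End G | ∃ (H : BisetCat.{u, w} R p) (x : G ⟶ H) (y : H ⟶ G),
    Nat.card H.carrier < Nat.card G.carrier ∧ f = x ≫ y}).toAddSubmonoid
  smul_mem' c f hf := by
    refine Submodule.span_induction (p := fun f _ => c • f ∈ Submodule.span R _) ?_ ?_ ?_ ?_ hf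
    · rintro _ ⟨H, x, y, h, rfl⟩
      exact Submodule.subset_span ⟨H, x, y ≫ c, h, Category.assoc x y c⟩
    · simp
    · intro a b _ _ ha hb
      rw [smul_add]
      exact add_mem ha hb
    · intro r a _ ha
      rw [smul_comm]
      exact Submodule.smul_mem _ r ha

instance (G : BisetCat.{u, w} R p) : (essentialIdeal G).IsTwoSided where
  mul_mem_of_left {f} c hf := by
    refine Submodule.span_induction (p := fun f _ => f * c ∈ Submodule.span R _) ?_ ?_ ?_ ?_ hf
    · rintro _ ⟨H, x, y, h, rfl⟩
      exact Submodule.subset_span ⟨H, c ≫ x, y, h, (Category.assoc c x y).symm⟩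
    · simp
    · intro a b _ _ ha hb
      rw [add_mul]
      exact add_mem ha hb
    · intro r a _ ha
      rw [smul_mul_assoc]
      exact Submodule.smul_mem _ r ha

/-- The essential algebra `E^Δ(G) = R B^Δ(G, G) / I_G`. -/
abbrev EssentialAlgebra (G : BisetCat.{u, w} R p) : Type (max (u + 1) w) :=
  End G ⧸ essentialIdeal G

end Category

instance innNormal (G : Type u) [Group G] : (MulAut.conj (G := G)).range.Normal where
  conj_mem := by
    rintro _ ⟨g, rfl⟩ a
    exact ⟨a g, by ext x; simp⟩

/-- The group `Out(G) = Aut(G) / Inn(G)`. -/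
abbrev Out (G : Type u) [Group G] : Type u := MulAut G ⧸ (MulAut.conj (G := G)).range

/-- The isomorphism `Out(G) ≃ Out(H)`, `[a] ↦ [f ∘ a ∘ f⁻¹]` induced by `f : G ≃* H`. -/
def outCongr {G H : Type u} [Group G] [Group H] (f : G ≃* H) : Out G ≃* Out H :=
  QuotientGroup.congr _ _ (MulAut.congr f) (by
    ext a
    constructor
    · rintro ⟨_, ⟨g, rfl⟩, rfl⟩
      exact ⟨f g, by ext x; simp⟩
    · rintro ⟨h, rfl⟩
      exact ⟨MulAut.conj (f.symm h), ⟨_, rfl⟩, by ext x; simp⟩)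

/-! ### `p`-bifree biset functors -/

section Functors

variable (R : Type w) [CommRing R] (p : ℕ) [Fact p.Prime]

/-- The category of `p`-bifree biset functors over `R`: the `R`-linear functors from `R C^Δ` to
`R`-modules, with natural transformations. -/
abbrev BisetFunctor :=
  ObjectProperty.FullSubcategory
    (fun F : BisetCat.{u, w} R p ⥤ ModuleCat.{max (u + 1) w} R => F.Additive ∧ F.Linear R)

end Functors

section Simple

variable {R : Type w} [CommRing R] {p : ℕ} [Fact p.Prime]

/-! Below, an `End(G)`-module `V` is an `R`-module `V` with an algebra morphism
`ρ : End(G) → End_R(V)`. -/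

variable (G : BisetCat.{u, w} R p) {V : Type (max (u + 1) w)} [AddCommGroup V] [Module R V]
  (ρ : End G →ₐ[R] Module.End R V)

/-- The relations `(x ∘ e) ⊗ v = x ⊗ e v`, for `e ∈ End(G)`, in `R B^Δ(H, G) ⊗_R V`. -/
noncomputable def balancedRel (H : BisetCat.{u, w} R p) : Submodule R ((G ⟶ H) ⊗[R] V) :=
  Submodule.span R
    {z | ∃ (x : G ⟶ H) (e : End G) (v : V), z = (e.asHom ≫ x) ⊗ₜ v - x ⊗ₜ (ρ e v)}

/-- The functor `L_{G,V}`, with `L_{G,V}(H) = R B^Δ(H, G) ⊗_{End(G)} V`. -/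
noncomputable def functorL : BisetCat.{u, w} R p ⥤ ModuleCat.{max (u + 1) w} R where
  obj H := ModuleCat.of R (((G ⟶ H) ⊗[R] V) ⧸ balancedRel G ρ H)
  map {H K} f := ModuleCat.ofHom <|
    (balancedRel G ρ H).mapQ (balancedRel G ρ K) ((Linear.rightComp R G f).rTensor V) (by
      rw [balancedRel, Submodule.span_le]
      rintro _ ⟨x, e, v, rfl⟩
      refine Submodule.subset_span ⟨x ≫ f, e, v, ?_⟩
      simp)
  map_id H := by
    apply ModuleCat.hom_ext
    apply Submodule.linearMap_qext
    apply TensorProduct.ext'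
    intro x v
    simp
  map_comp f g := by
    apply ModuleCat.hom_ext
    apply Submodule.linearMap_qext
    apply TensorProduct.ext'
    intro x v
    simp

/-- For `y ∈ R B^Δ(G, H)`, the map `L_{G,V}(H) → V`, `x ⊗ v ↦ (y ∘ x) v`. -/
noncomputable def evalL {H : BisetCat.{u, w} R p} (y : H ⟶ G) :
    (functorL G ρ).obj H →ₗ[R] V :=
  (balancedRel G ρ H).liftQ
    (TensorProduct.lift
      { toFun := fun x => ρ (x ≫ y : G ⟶ G)
        map_add' := fun x x' => by rw [Preadditive.add_comp]; exact map_add ρ _ _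
        map_smul' := fun r x => by rw [Linear.smul_comp]; exact map_smul ρ r _ }) (by
      rw [balancedRel, Submodule.span_le]
      rintro _ ⟨x, e, v, rfl⟩
      have h : ρ ((e.asHom ≫ x) ≫ y : G ⟶ G) = ρ (x ≫ y : G ⟶ G) * ρ e := by
        rw [Category.assoc]
        exact map_mul ρ (show End G from x ≫ y) e
      change TensorProduct.lift _ _ = 0
      rw [map_sub, TensorProduct.lift.tmul, TensorProduct.lift.tmul, sub_eq_zero]
      exact DFunLike.congr_fun h v)

theorem evalL_map {H K : BisetCat.{u, w} R p} (f : H ⟶ K) (y : K ⟶ G)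
    (z : (functorL G ρ).obj H) :
    evalL G ρ y ((functorL G ρ).map f z) = evalL G ρ (f ≫ y) z := by
  have h : evalL G ρ y ∘ₗ ((functorL G ρ).map f).hom = evalL G ρ (f ≫ y) := by
    apply Submodule.linearMap_qext
    apply TensorProduct.ext'
    intro x v
    exact congrArg (fun e : G ⟶ G => ρ e v) (Category.assoc x f y)
  exact DFunLike.congr_fun h z

/-- The subfunctor `J_{G,V}` of `L_{G,V}`: the elements `∑ xᵢ ⊗ vᵢ` of `L_{G,V}(H)` such that
`∑ (y ∘ xᵢ) vᵢ = 0` for all `y ∈ R B^Δ(G, H)`. -/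
noncomputable def subJ (H : BisetCat.{u, w} R p) : Submodule R ((functorL G ρ).obj H) :=
  ⨅ y : H ⟶ G, LinearMap.ker (evalL G ρ y)

/-- The functor `L_{G,V} / J_{G,V}`. -/
noncomputable def functorLJ : BisetCat.{u, w} R p ⥤ ModuleCat.{max (u + 1) w} R where
  obj H := ModuleCat.of R ((functorL G ρ).obj H ⧸ subJ G ρ H)
  map {H K} f := ModuleCat.ofHom <|
    (subJ G ρ H).mapQ (subJ G ρ K) ((functorL G ρ).map f).hom (by
      intro z hz
      simp only [subJ, Submodule.mem_comap, Submodule.mem_iInf, LinearMap.mem_ker] at hz ⊢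
      exact fun y => (evalL_map G ρ f y z).trans (hz _))
  map_id H := by
    apply ModuleCat.hom_ext
    apply Submodule.linearMap_qext
    ext z
    simp
  map_comp f g := by
    apply ModuleCat.hom_ext
    apply Submodule.linearMap_qext
    ext z
    simp

theorem functorL_map_add {H K : BisetCat.{u, w} R p} (f g : H ⟶ K) :
    (functorL G ρ).map (f + g) = (functorL G ρ).map f + (functorL G ρ).map g := by
  apply ModuleCat.hom_ext
  apply Submodule.linearMap_qext
  apply TensorProduct.ext'
  intro x v
  refine congrArg (balancedRel G ρ K).mkQ (?_ : (x ≫ (f + g)) ⊗ₜ[R] v = _ ⊗ₜ v + _ ⊗ₜ v)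
  rw [Preadditive.comp_add, TensorProduct.add_tmul]
  rfl

theorem functorL_map_smul {H K : BisetCat.{u, w} R p} (f : H ⟶ K) (r : R) :
    (functorL G ρ).map (r • f) = r • (functorL G ρ).map f := by
  apply ModuleCat.hom_ext
  apply Submodule.linearMap_qext
  apply TensorProduct.ext'
  intro x v
  refine congrArg (balancedRel G ρ K).mkQ (?_ : (x ≫ (r • f)) ⊗ₜ[R] v = r • (_ ⊗ₜ v))
  rw [Linear.comp_smul, TensorProduct.smul_tmul']
  rfl

/-- The `p`-bifree biset functor `S^Δ_{G,V} = L_{G,V} / J_{G,V}`. -/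
noncomputable def functorS : BisetFunctor.{u, w} R p where
  obj := functorLJ G ρ
  property := by
    refine ⟨⟨fun {H K f g} => ?_⟩, ⟨fun {H K} f r => ?_⟩⟩
    · apply ModuleCat.hom_ext
      apply Submodule.linearMap_qext
      ext z
      exact congrArg (fun h => (subJ G ρ K).mkQ (h.hom z)) (functorL_map_add G ρ f g)
    · apply ModuleCat.hom_ext
      apply Submodule.linearMap_qext
      ext z
      exact congrArg (fun h => (subJ G ρ K).mkQ (h.hom z)) (functorL_map_smul G ρ f r)

variable {G} in
/-- An `R Out(G)`-module `V`, viewed as a module for `End(G) = R B^Δ(G, G)` through the projection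
onto the essential algebra, followed by an isomorphism `e` of the essential algebra with
`R Out(G)`. -/
noncomputable def inflate (e : EssentialAlgebra G ≃ₐ[R] MonoidAlgebra R (Out G.carrier))
    (V : Type (max (u + 1) w)) [AddCommGroup V] [Module R V]
    [Module (MonoidAlgebra R (Out G.carrier)) V]
    [IsScalarTower R (MonoidAlgebra R (Out G.carrier)) V] : End G →ₐ[R] Module.End R V :=
  (Algebra.lsmul R R V).comp
    (e.toAlgHom.comp (Ideal.Quotient.mkₐ R (essentialIdeal G)))

end Simple

end PBifree

/-!
A transitive `p`-bifree `(H, G)`-biset `X` with `|H| ≤ |G|` is either the biset of an isomorphism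
`G ≃* H` or factors through a group of order less than `|G|`: the stabilizer of a point in `H × G`
is the graph of an isomorphism between quotients of subgroups of `G` and `H` by normal subgroups of
order prime to `p`, and `X` is composed through the quotient of the subgroup of `G`. Hence the
bisets of automorphisms span `E^Δ(G)`, inner automorphisms giving the identity. Conversely, summing
over the left orbits of a `(G, G)`-biset the classes of the automorphisms by which the right action
differs from the left one gives a linear map `R B^Δ(G, G) → R Out(G)`. It vanishes on the bisets
which factor through a group `K` with `|K| < |G|`, since there no point has a trivial left
stabilizer and the same left and right orbit, and it is the inverse isomorphism.

A linear functor is determined by its value at `G`, as an `End(G)`-module, if its values are spanned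
by the images of elements of its value at `G` and if the morphisms to `G` separate their elements.
`S_{G,V}` has both properties, and so does a simple functor with a nonzero value at `G`. If `|G|` is
minimal among the groups at which a simple functor is nonzero, `I_G` acts as zero on its value at
`G`, which is therefore a simple `R Out(G)`-module. If `S_{G,V} ≅ S_{H,W}`, some composition
`G → H → G` is not in `I_G` and some composition `H → G → H` is not in `I_H`, so that `|G| = |H|`
and `G ≃ H`.
-/

namespace PBifree

/-! ### Transitive bisets -/

theorem exists_eq_graph_of_card_le {G H : Type*} [Group G] [Group H] [Finite G] [Finite H]
    (hc : Nat.card H ≤ Nat.card G) {L : Subgroup (G × H)} (hfst : L.map (MonoidHom.fst G H) = ⊤)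
    (hker : L.goursatFst = ⊥) : ∃ f : G ≃* H, L = f.toMonoidHom.graph := by
  have hsurj : Function.Surjective (Prod.fst ∘ L.subtype) := fun g => by
    obtain ⟨q, hq, rfl⟩ : g ∈ L.map (MonoidHom.fst G H) := hfst ▸ Subgroup.mem_top g
    exact ⟨⟨q, hq⟩, rfl⟩
  have hinj : Function.Injective (Prod.snd ∘ L.subtype) := by
    refine (injective_iff_map_eq_one ((MonoidHom.snd G H).comp L.subtype)).mpr ?_
    rintro ⟨⟨g, h⟩, hq⟩ (rfl : h = 1)
    have hg : g ∈ L.goursatFst := Subgroup.mem_goursatFst.mpr hq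
    rw [hker, Subgroup.mem_bot] at hg
    exact Subtype.ext (Prod.ext hg rfl)
  have hGL : Nat.card G ≤ Nat.card L := Nat.card_le_card_of_surjective _ hsurj
  have hLH : Nat.card L ≤ Nat.card H := Nat.card_le_card_of_injective _ hinj
  exact Subgroup.exists_mulEquiv_eq_graph
    ((Nat.bijective_iff_surjective_and_card _).mpr ⟨hsurj, by lia⟩)
    ((Nat.bijective_iff_injective_and_card _).mpr ⟨hinj, by lia⟩)

namespace Biset

section Constructions

variable {p : ℕ} {H G : Type u} [Group H] [Group G]

/-- The sub-biset carried by a subset stable under both actions. -/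
def sub (X : Biset p H G) (S : Set X.carrier) (hl : ∀ (h : H) x, h • x ∈ S ↔ x ∈ S)
    (hr : ∀ (g : G) x, op g • x ∈ S ↔ x ∈ S) : Biset p H G :=
  letI : MulAction H S :=
    { smul := fun h x => ⟨h • x.1, (hl h x.1).mpr x.2⟩
      one_smul := fun x => Subtype.ext (one_smul H x.1)
      mul_smul := fun a b x => Subtype.ext (mul_smul a b x.1) }
  letI : MulAction Gᵐᵒᵖ S :=
    { smul := fun g x => ⟨g • x.1, (hr g.unop x.1).mpr x.2⟩
      one_smul := fun x => Subtype.ext (one_smul Gᵐᵒᵖ x.1)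
      mul_smul := fun a b x => Subtype.ext (mul_smul a b x.1) }
  { carrier := S
    comm := ⟨fun h g x => Subtype.ext (smul_comm h g x.1)⟩
    left_stab := fun x => by
      rw [show MulAction.stabilizer H x = MulAction.stabilizer H x.1 from
        Subgroup.ext fun _ => Subtype.ext_iff]
      exact X.left_stab x.1
    right_stab := fun x => by
      rw [show MulAction.stabilizer Gᵐᵒᵖ x = MulAction.stabilizer Gᵐᵒᵖ x.1 from
        Subgroup.ext fun _ => Subtype.ext_iff]
      exact X.right_stab x.1 }

theorem sub_sum_sub_compl (X : Biset p H G) (S : Set X.carrier)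
    (hl : ∀ (h : H) x, h • x ∈ S ↔ x ∈ S) (hr : ∀ (g : G) x, op g • x ∈ S ↔ x ∈ S) :
    (X.sub S hl hr).sum (X.sub Sᶜ (fun h x => (hl h x).not) fun g x => (hr g x).not) ≈ X := by
  classical
  refine ⟨⟨Equiv.Set.sumCompl S, ?_, ?_⟩⟩
  · rintro h (x | x) <;> rfl
  · rintro g (x | x) <;> rfl

/-- The restriction of the right action to a subgroup. -/
def resRight (X : Biset p H G) (P : Subgroup G) : Biset p H P :=
  letI : MulAction (P : Type u)ᵐᵒᵖ X.carrier := MulAction.compHom X.carrier P.subtype.op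
  { carrier := X.carrier
    comm := ⟨fun h q x => smul_comm h (op (q.unop : G)) x⟩
    left_stab := X.left_stab
    right_stab := fun x => by
      refine mt (fun h => h.trans ?_) (X.right_stab x)
      let φ : MulAction.stabilizer (P : Type u)ᵐᵒᵖ x →* MulAction.stabilizer Gᵐᵒᵖ x :=
        (P.subtype.op.comp (Subgroup.subtype _)).codRestrict _ fun q => q.2
      refine Subgroup.card_dvd_of_injective φ fun a b hab => ?_
      have h : op ((a.1.unop : P) : G) = op ((b.1.unop : P) : G) := congrArg Subtype.val hab
      exact Subtype.ext (unop_injective (Subtype.ext (op_injective h))) }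

/-- The right action of `G ⧸ N` on a biset on which the normal subgroup `N` acts trivially. -/
def descRight (X : Biset p H G) (N : Subgroup G) [N.Normal]
    (hN : ∀ n ∈ N, ∀ x : X.carrier, op n • x = x) : Biset p H (G ⧸ N) :=
  letI : MulAction (G ⧸ N)ᵐᵒᵖ X.carrier :=
    { smul := fun q x => Quotient.liftOn' q.unop (fun g => op g • x) (fun a b hab => by
        have h := hN _ (QuotientGroup.leftRel_apply.mp hab) (op a • x)
        rw [← mul_smul, ← op_mul, mul_inv_cancel_left] at h
        exact h.symm)
      one_smul := fun x => one_smul Gᵐᵒᵖ x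
      mul_smul := by
        intro a b x
        induction a using MulOpposite.rec' with | _ a
        induction b using MulOpposite.rec' with | _ b
        obtain ⟨a, rfl⟩ := QuotientGroup.mk_surjective a
        obtain ⟨b, rfl⟩ := QuotientGroup.mk_surjective b
        exact mul_smul (op a) (op b) x }
  { carrier := X.carrier
    comm := ⟨by
      intro h q x
      induction q using MulOpposite.rec' with | _ q
      obtain ⟨q, rfl⟩ := QuotientGroup.mk_surjective q
      exact smul_comm h (op q) x⟩
    left_stab := X.left_stab
    right_stab := fun x => by
      refine mt (fun h => h.trans ?_) (X.right_stab x)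
      let φ : MulAction.stabilizer Gᵐᵒᵖ x →* MulAction.stabilizer (G ⧸ N)ᵐᵒᵖ x :=
        ((QuotientGroup.mk' N).op.comp (Subgroup.subtype _)).codRestrict _ fun q => q.2
      refine Subgroup.card_dvd_of_surjective φ ?_
      rintro ⟨q, hq⟩
      induction q using MulOpposite.rec' with | _ q
      obtain ⟨q, rfl⟩ := QuotientGroup.mk_surjective q
      exact ⟨⟨op q, hq⟩, rfl⟩ }

variable [Fact p.Prime] [Finite G]

variable (p) in
/-- The group `G` as a `(P, G)`-biset, for a subgroup `P` of `G`. -/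
def restriction (P : Subgroup G) : Biset p P G where
  carrier := G
  comm := ⟨fun a b x => (mul_assoc (a : G) x b.unop).symm⟩
  left_stab := fun x => by
    have h : MulAction.stabilizer P x = ⊥ := by
      ext a
      rw [MulAction.mem_stabilizer_iff, Subgroup.mem_bot, Subgroup.smul_def, smul_eq_mul,
        mul_eq_right, OneMemClass.coe_eq_one]
    rw [h, Subgroup.card_bot]
    exact (Fact.out : p.Prime).one_lt.ne' ∘ Nat.dvd_one.mp
  right_stab := (ofIso p (MulEquiv.refl G)).right_stab

/-- The quotient group `G ⧸ N` as a `(G ⧸ N, G)`-biset, for a normal subgroup `N` of order prime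
to `p`. -/
def deflation (N : Subgroup G) [N.Normal] (hN : ¬ p ∣ Nat.card N) : Biset p (G ⧸ N) G :=
  letI : MulAction Gᵐᵒᵖ (G ⧸ N) := MulAction.compHom (G ⧸ N) (QuotientGroup.mk' N).op
  { carrier := G ⧸ N
    comm := ⟨fun a b x => (mul_assoc a x (b.unop : G ⧸ N)).symm⟩
    left_stab := (ofIso p (MulEquiv.refl (G ⧸ N))).left_stab
    right_stab := fun x => by
      refine mt (fun h => h.trans ?_) hN
      refine dvd_of_eq (Nat.card_congr (Equiv.subtypeEquiv opEquiv.symm fun a => ?_))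
      rw [MulAction.mem_stabilizer_iff]
      change x * (a.unop : G ⧸ N) = x ↔ a.unop ∈ N
      rw [mul_eq_left, QuotientGroup.eq_one_iff] }

end Constructions

section Composition

variable {p : ℕ} [Fact p.Prime] {K H G : Type u} [Group K] [Group H] [Group G] [Finite G]

theorem comp_equiv_of_balanced [Finite K] {Y : Biset p K H} {Z : Biset p H G} {X : Biset p K G}
    (m : Y.carrier → Z.carrier → X.carrier) (hl : ∀ (k : K) y z, m (k • y) z = k • m y z)
    (hr : ∀ (g : G) y z, m y (op g • z) = op g • m y z) (hs : ∀ x, ∃ y z, m y z = x)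
    (hm : ∀ y z y' z', m y z = m y' z' ↔ ∃ h : H, y = op h • y' ∧ h • z = z') :
    Y.comp Z ≈ X := by
  refine ⟨⟨Equiv.ofBijective (Quotient.lift (fun a => m a.1 a.2)
    fun a b hab => (hm _ _ _ _).mpr hab) ⟨?_, ?_⟩, ?_, ?_⟩⟩
  · rintro ⟨a⟩ ⟨b⟩ hab
    exact Quotient.sound ((hm _ _ _ _).mp hab)
  · intro x
    obtain ⟨y, z, h⟩ := hs x
    exact ⟨Quotient.mk _ (y, z), h⟩
  · rintro k ⟨y, z⟩
    exact hl k y z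
  · rintro g ⟨y, z⟩
    exact hr g y z

theorem ofIso_comp_ofIso [Finite K] [Finite H] (f : H ≃* K) (g : G ≃* H) :
    (ofIso p f).comp (ofIso p g) ≈ ofIso p (g.trans f) := by
  refine comp_equiv_of_balanced (X := ofIso p (g.trans f)) (fun (k : K) (h : H) => k * f h)
    ?_ ?_ ?_ ?_
  · exact fun k (y : K) (z : H) => mul_assoc k y (f z)
  · intro a (y : K) (z : H)
    change y * f (z * g a) = y * f z * f (g a)
    rw [map_mul, mul_assoc]
  · exact fun (k : K) => ⟨k, (1 : H), by rw [map_one]; exact mul_one k⟩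
  · intro (k : K) (h : H) (k' : K) (h' : H)
    change k * f h = k' * f h' ↔ ∃ l : H, k = k' * f l ∧ l * h = h'
    constructor
    · intro e
      refine ⟨h' * h⁻¹, ?_, inv_mul_cancel_right h' h⟩
      rw [map_mul, ← mul_assoc, ← e, map_inv, mul_inv_cancel_right]
    · rintro ⟨l, rfl, rfl⟩
      rw [map_mul, mul_assoc]

theorem ofIso_conj (g : G) : ofIso p (MulAut.conj g) ≈ ofIso p (MulEquiv.refl G) := by
  refine ⟨⟨(Equiv.mulRight g : G ≃ G), ?_, ?_⟩⟩
  · exact fun (h : G) (x : G) => mul_assoc h x g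
  · intro (h : G) (x : G)
    change x * (g * h * g⁻¹) * g = x * g * h
    group

variable [Finite H]

/-- The biset `X` is induced from the block `S`: it is `S ×_P G`. -/
theorem resRight_sub_comp_restriction (X : Biset p H G) (P : Subgroup G) (S : Set X.carrier)
    (hl : ∀ (h : H) x, h • x ∈ S ↔ x ∈ S) (hr : ∀ (q : P) x, op (q : G) • x ∈ S ↔ x ∈ S)
    (hS : ∀ x : X.carrier, ∃ g : G, op g • x ∈ S)
    (hP : ∀ s ∈ S, ∀ g : G, op g • s ∈ S → g ∈ P) :
    ((X.resRight P).sub S hl hr).comp (restriction p P) ≈ X := by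
  refine comp_equiv_of_balanced (X := X) (fun (s : S) (g : G) => op g • (s : X.carrier)) ?_ ?_ ?_ ?_
  · exact fun h (s : S) (g : G) => (smul_comm h (op g) (s : X.carrier)).symm
  · exact fun g (s : S) (z : G) => mul_smul (op g) (op z) (s : X.carrier)
  · intro x
    obtain ⟨g, hg⟩ := hS x
    exact ⟨⟨op g • x, hg⟩, (g⁻¹ : G), inv_smul_smul (op g) x⟩
  · intro (s : S) (g : G) (s' : S) (g' : G)
    change op g • s.1 = op g' • s'.1 ↔ ∃ q : P, s = _ ∧ (q : G) * g = g'
    constructor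
    · intro e
      have hs : s.1 = op (g' * g⁻¹) • s'.1 := by
        rw [op_mul, mul_smul, ← e, MulOpposite.op_inv, inv_smul_smul]
      exact ⟨⟨g' * g⁻¹, hP s'.1 s'.2 _ (hs ▸ s.2)⟩, Subtype.ext hs, inv_mul_cancel_right g' g⟩
    · rintro ⟨q, hs, rfl⟩
      have hs : s.1 = op (q : G) • s'.1 := congrArg Subtype.val hs
      rw [hs, ← mul_smul, ← op_mul]

theorem descRight_comp_deflation (X : Biset p H G) (N : Subgroup G) [N.Normal]
    (hcard : ¬ p ∣ Nat.card N) (hN : ∀ n ∈ N, ∀ x : X.carrier, op n • x = x) :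
    (X.descRight N hN).comp (deflation N hcard) ≈ X := by
  let Y := X.descRight N hN
  refine comp_equiv_of_balanced (X := X) (fun (y : Y.carrier) (q : G ⧸ N) => (op q • y : Y.carrier))
    ?_ ?_ ?_ ?_
  · exact fun h y (q : G ⧸ N) => (smul_comm h (op q) y).symm
  · exact fun g y q => mul_smul (op (g : G ⧸ N)) (op (show G ⧸ N from q)) y
  · exact fun y => ⟨y, (1 : G ⧸ N), one_smul (G ⧸ N)ᵐᵒᵖ (show Y.carrier from y)⟩
  · intro y (q : G ⧸ N) y' (q' : G ⧸ N)
    change op q • y = op q' • y' ↔ ∃ r : G ⧸ N, y = op r • y' ∧ r * q = q'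
    constructor
    · intro e
      refine ⟨q' * q⁻¹, ?_, inv_mul_cancel_right q' q⟩
      rw [op_mul, mul_smul, ← e, MulOpposite.op_inv, inv_smul_smul]
    · rintro ⟨r, rfl, rfl⟩
      rw [← mul_smul, ← op_mul]

end Composition

section Bistabilizer

variable {p : ℕ} {K H G : Type u} [Group K] [Group H] [Group G]

/-- The stabilizer of `x` under both actions, as a subgroup of `G × H`: the pairs `(g, h)` such
that `g` acts on `x` from the right as `h` does from the left. -/
def bistabilizer (X : Biset p H G) (x : X.carrier) : Subgroup (G × H) where
  carrier := {q | q.2 • x = op q.1 • x}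
  one_mem' := by simp
  mul_mem' := by
    rintro ⟨a, h⟩ ⟨b, k⟩ (hh : h • x = op a • x) (hk : k • x = op b • x)
    change (h * k) • x = op (a * b) • x
    rw [mul_smul, hk, smul_comm, hh, op_mul, mul_smul]
  inv_mem' := by
    rintro ⟨a, h⟩ (hh : h • x = op a • x)
    change h⁻¹ • x = op a⁻¹ • x
    rw [inv_smul_eq_iff, smul_comm, hh, MulOpposite.op_inv, inv_smul_smul]

/-- The elements of `G` which act on `x` from the right as an element of `H` does from the
left. -/
def rightSupport (X : Biset p H G) (x : X.carrier) : Subgroup G :=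
  (X.bistabilizer x).map (MonoidHom.fst G H)

/-- The stabilizer of `x` for the right action, as a subgroup of `G`. -/
def rightStab (X : Biset p H G) (x : X.carrier) : Subgroup G :=
  (X.bistabilizer x).goursatFst

/-- The left stabilizer of `x` is trivial, and `g` acts on `x` from the right as `f g` does from
the left. -/
def IsTwist (X : Biset p H G) (x : X.carrier) (f : G ≃* H) : Prop :=
  X.bistabilizer x = f.toMonoidHom.graph

/-- The orbit of `x` under both actions. -/
def biorbit (X : Biset p H G) (x : X.carrier) : Set X.carrier :=
  {y | ∃ (h : H) (g : G), h • op g • x = y}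

theorem mem_rightSupport {X : Biset p H G} {x : X.carrier} {g : G} :
    g ∈ X.rightSupport x ↔ ∃ h : H, h • x = op g • x :=
  ⟨by rintro ⟨⟨g, h⟩, hq, rfl⟩; exact ⟨h, hq⟩, fun ⟨h, hh⟩ => ⟨(g, h), hh, rfl⟩⟩

theorem mem_rightStab {X : Biset p H G} {x : X.carrier} {g : G} :
    g ∈ X.rightStab x ↔ op g • x = x := by
  refine Subgroup.mem_goursatFst.trans (Iff.trans ?_ eq_comm)
  exact Eq.congr_left (one_smul H x)

theorem isTwist_iff {X : Biset p H G} {x : X.carrier} {f : G ≃* H} :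
    X.IsTwist x f ↔ ∀ g h, h • x = op g • x ↔ f g = h := by
  rw [IsTwist, SetLike.ext_iff, Prod.forall]
  rfl

theorem smul_mem_biorbit (X : Biset p H G) (x : X.carrier) (h : H) (y : X.carrier) :
    h • y ∈ X.biorbit x ↔ y ∈ X.biorbit x := by
  constructor
  · rintro ⟨k, g, e⟩
    exact ⟨h⁻¹ * k, g, by rw [mul_smul, e, inv_smul_smul]⟩
  · rintro ⟨k, g, rfl⟩
    exact ⟨h * k, g, mul_smul h k _⟩

theorem op_smul_mem_biorbit (X : Biset p H G) (x : X.carrier) (g : G) (y : X.carrier) :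
    op g • y ∈ X.biorbit x ↔ y ∈ X.biorbit x := by
  constructor
  · rintro ⟨k, a, e⟩
    refine ⟨k, a * g⁻¹, ?_⟩
    rw [op_mul, mul_smul, smul_comm, e, MulOpposite.op_inv, inv_smul_smul]
  · rintro ⟨k, a, rfl⟩
    exact ⟨k, a * g, by rw [op_mul, mul_smul, smul_comm]⟩

theorem not_dvd_card_rightStab (X : Biset p H G) (x : X.carrier) :
    ¬ p ∣ Nat.card (X.rightStab x) := by
  have h : Nat.card (X.rightStab x) = Nat.card (MulAction.stabilizer Gᵐᵒᵖ x) :=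
    Nat.card_congr (Equiv.subtypeEquiv opEquiv fun _ => mem_rightStab)
  rw [h]
  exact X.right_stab x

theorem rightStab_normal {X : Biset p H G} {x : X.carrier} (hP : X.rightSupport x = ⊤) :
    (X.rightStab x).Normal := by
  refine Subgroup.normal_goursatFst fun g => ?_
  obtain ⟨q, hq, rfl⟩ : g ∈ X.rightSupport x := hP ▸ Subgroup.mem_top g
  exact ⟨⟨q, hq⟩, rfl⟩

theorem orbit_eq_univ_of_rightSupport_eq_top {X : Biset p H G} {x : X.carrier}
    (hx : X.biorbit x = Set.univ) (hP : X.rightSupport x = ⊤) :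
    MulAction.orbit H x = Set.univ := by
  refine Set.eq_univ_of_forall fun y => ?_
  obtain ⟨h, g, rfl⟩ : y ∈ X.biorbit x := hx ▸ Set.mem_univ y
  obtain ⟨k, hk⟩ := mem_rightSupport.mp (hP ▸ Subgroup.mem_top g : g ∈ X.rightSupport x)
  exact ⟨h * k, (mul_smul h k x).trans (congrArg (h • ·) hk)⟩

theorem ofIso_equiv_of_isTwist [Fact p.Prime] [Finite H] {X : Biset p H G} {x : X.carrier}
    {f : G ≃* H} (hf : X.IsTwist x f) (hx : MulAction.orbit H x = Set.univ) : ofIso p f ≈ X := by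
  rw [isTwist_iff] at hf
  have hinj : Function.Injective fun h : H => h • x := fun a b hab => by
    have h := (hf 1 (b⁻¹ * a)).mp (by
      rw [mul_smul, show a • x = b • x from hab, inv_smul_smul, op_one, one_smul])
    rw [map_one] at h
    exact (inv_mul_eq_one.mp h.symm).symm
  refine ⟨⟨Equiv.ofBijective (fun h : H => h • x) ⟨hinj, fun y => ?_⟩, ?_, ?_⟩⟩
  · exact (hx ▸ Set.mem_univ y : y ∈ MulAction.orbit H x)
  · exact fun h k => mul_smul (α := H) h k x
  · intro g (k : H)
    change (k * f g) • x = op g • k • x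
    rw [mul_smul, (hf g (f g)).mpr rfl, smul_comm]

/-- `X` is a composition through a group of order smaller than that of `G`. -/
def FactorsThroughSmaller [Fact p.Prime] [Finite H] [Finite G] (X : Biset p H G) : Prop :=
  ∃ (Q : Type u) (_ : Group Q) (_ : Finite Q) (Y : Biset p H Q) (Z : Biset p Q G),
    Nat.card Q < Nat.card G ∧ Y.comp Z ≈ X

section Transitive

variable [Fact p.Prime] [Finite H] [Finite G] {X : Biset p H G} {x : X.carrier}

theorem factorsThroughSmaller_of_rightSupport_ne_top (hx : X.biorbit x = Set.univ)
    (hP : X.rightSupport x ≠ ⊤) : X.FactorsThroughSmaller := by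
  have hblock : ∀ (g : G), ∀ s ∈ MulAction.orbit H x,
      (op g • s ∈ MulAction.orbit H x ↔ g ∈ X.rightSupport x) := by
    rintro g _ ⟨h, rfl⟩
    rw [mem_rightSupport]
    constructor
    · rintro ⟨k, hk : k • x = op g • h • x⟩
      exact ⟨h⁻¹ * k, by rw [mul_smul, hk, smul_comm, inv_smul_smul]⟩
    · rintro ⟨k, hk⟩
      exact ⟨h * k, by change (h * k) • x = op g • h • x; rw [mul_smul, hk, smul_comm]⟩
  refine ⟨X.rightSupport x, inferInstance, inferInstance, _, _, ?_,
    X.resRight_sub_comp_restriction (X.rightSupport x) (MulAction.orbit H x) (fun h y => ?_)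
      (fun q y => ?_) (fun y => ?_) fun s hs g hg => (hblock g s hs).mp hg⟩
  · exact (Subgroup.card_le_card_group _).lt_of_ne fun h => hP (Subgroup.eq_top_of_card_eq _ h)
  · rw [← MulAction.orbit_eq_iff, MulAction.orbit_smul, MulAction.orbit_eq_iff]
  · refine ⟨fun hy => ?_, fun hy => (hblock q y hy).mpr q.2⟩
    have := (hblock (q⁻¹ : X.rightSupport x) _ hy).mpr (q⁻¹).2
    rwa [Subgroup.coe_inv, MulOpposite.op_inv, inv_smul_smul] at this
  · obtain ⟨h, g, rfl⟩ : y ∈ X.biorbit x := hx ▸ Set.mem_univ y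
    exact ⟨g⁻¹, h, by rw [MulOpposite.op_inv, smul_comm h, inv_smul_smul]⟩

theorem factorsThroughSmaller_of_rightStab_ne_bot (hx : X.biorbit x = Set.univ)
    (hP : X.rightSupport x = ⊤) (hN : X.rightStab x ≠ ⊥) : X.FactorsThroughSmaller := by
  have := rightStab_normal hP
  have htriv : ∀ n ∈ X.rightStab x, ∀ y : X.carrier, op n • y = y := by
    intro n hn y
    obtain ⟨h, rfl⟩ : y ∈ MulAction.orbit H x :=
      orbit_eq_univ_of_rightSupport_eq_top hx hP ▸ Set.mem_univ y
    exact (smul_comm h (op n) x).symm.trans (congrArg (h • ·) (mem_rightStab.mp hn))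
  refine ⟨G ⧸ X.rightStab x, inferInstance, inferInstance, _, _, ?_,
    X.descRight_comp_deflation (X.rightStab x) (X.not_dvd_card_rightStab x) htriv⟩
  rw [Subgroup.card_eq_card_quotient_mul_card_subgroup (X.rightStab x)]
  exact lt_mul_of_one_lt_right Nat.card_pos ((Subgroup.one_lt_card_iff_ne_bot _).mpr hN)

theorem factorsThroughSmaller_or_exists_ofIso_equiv (hc : Nat.card H ≤ Nat.card G)
    (hx : X.biorbit x = Set.univ) : X.FactorsThroughSmaller ∨ ∃ f : G ≃* H, ofIso p f ≈ X := by
  by_cases hP : X.rightSupport x = ⊤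
  · by_cases hN : X.rightStab x = ⊥
    · obtain ⟨f, hf⟩ := exists_eq_graph_of_card_le hc hP hN
      exact .inr ⟨f, ofIso_equiv_of_isTwist hf (orbit_eq_univ_of_rightSupport_eq_top hx hP)⟩
    · exact .inl (factorsThroughSmaller_of_rightStab_ne_bot hx hP hN)
  · exact .inl (factorsThroughSmaller_of_rightSupport_ne_top hx hP)

end Transitive

theorem IsTwist.card_le [Fact p.Prime] [Finite K] [Finite H] [Finite G] {Y : Biset p K H}
    {Z : Biset p H G} {x : (Y.comp Z).carrier} {f : G ≃* K} (hf : (Y.comp Z).IsTwist x f) :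
    Nat.card G ≤ Nat.card H := by
  rw [isTwist_iff] at hf
  obtain ⟨⟨y, z⟩, rfl⟩ := Quotient.exists_rep x
  have hex : ∀ g : G, ∃ h : H, op h • y = f g • y := fun g => by
    obtain ⟨h, hy, -⟩ := Quotient.exact ((hf g (f g)).mpr rfl)
    exact ⟨h, hy.symm⟩
  choose σ hσ using hex
  refine Nat.card_le_card_of_injective σ fun a b hab => ?_
  have hy : f a • y = f b • y := by rw [← hσ, ← hσ, hab]
  refine f.injective ((hf b (f a)).mp (Eq.trans ?_ ((hf b (f b)).mpr rfl))).symm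
  exact congrArg (fun y => Quotient.mk (compSetoid Y Z) (y, z)) hy

end Bistabilizer

end Biset

/-! ### The sum of the twists of a biset -/

/-- The orbits on a disjoint union are those on the two summands. -/
def orbitRelQuotientSumEquiv (G α β : Type*) [Group G] [MulAction G α] [MulAction G β] :
    MulAction.orbitRel.Quotient G (α ⊕ β) ≃
      MulAction.orbitRel.Quotient G α ⊕ MulAction.orbitRel.Quotient G β where
  toFun := Quotient.lift (Sum.map (Quotient.mk _) (Quotient.mk _)) (by
    rintro _ (a | b) ⟨k, rfl⟩
    exacts [congrArg Sum.inl (Quotient.sound ⟨k, rfl⟩), congrArg Sum.inr (Quotient.sound ⟨k, rfl⟩)])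
  invFun := Sum.elim
    (Quotient.map Sum.inl (by rintro _ _ ⟨k, rfl⟩; exact ⟨k, rfl⟩))
    (Quotient.map Sum.inr (by rintro _ _ ⟨k, rfl⟩; exact ⟨k, rfl⟩))
  left_inv := by rintro ⟨a | b⟩ <;> rfl
  right_inv := by
    rintro (ω | ω) <;>
    · obtain ⟨a, rfl⟩ := Quotient.exists_rep ω
      rfl

theorem mk_conj_eq_one {G : Type*} [Group G] (g : G) :
    (QuotientGroup.mk (MulAut.conj g) : Out G) = 1 :=
  (QuotientGroup.eq_one_iff _).mpr ⟨g, rfl⟩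

namespace Biset

section Twist

variable {p : ℕ} {H G : Type u} [Group H] [Group G]

theorem IsTwist.smul {X : Biset p H G} {x : X.carrier} {f : G ≃* H} (hf : X.IsTwist x f) (k : H) :
    X.IsTwist (k • x) (f.trans (MulAut.conj k)) := by
  rw [isTwist_iff] at hf ⊢
  intro g h
  calc h • k • x = op g • k • x
    _ ↔ (k⁻¹ * h * k) • x = op g • x := by
        rw [← smul_comm k (op g) x, mul_smul, mul_smul, inv_smul_eq_iff]
    _ ↔ f g = k⁻¹ * h * k := hf g _
    _ ↔ k * f g * k⁻¹ = h := by rw [mul_assoc k⁻¹, eq_inv_mul_iff_mul_eq, mul_inv_eq_iff_eq_mul]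

theorem IsTwist.unique {X : Biset p H G} {x : X.carrier} {f f' : G ≃* H} (hf : X.IsTwist x f)
    (hf' : X.IsTwist x f') : f = f' := by
  ext g
  exact (isTwist_iff.mp hf g (f' g)).mp ((isTwist_iff.mp hf' g (f' g)).mpr rfl)

theorem isTwist_map_iff {X Y : Biset p H G} {i : X.carrier → Y.carrier}
    (hi : Function.Injective i) (hl : ∀ (h : H) x, i (h • x) = h • i x)
    (hr : ∀ (g : G) x, i (op g • x) = op g • i x) {x : X.carrier} {f : G ≃* H} :
    Y.IsTwist (i x) f ↔ X.IsTwist x f := by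
  simp only [isTwist_iff, ← hl, ← hr, hi.eq_iff]

theorem isTwist_ofIso_one [Fact p.Prime] [Finite H] (f : G ≃* H) :
    (ofIso p f).IsTwist (1 : H) f := by
  refine isTwist_iff.mpr fun g h => ?_
  change h * 1 = 1 * f g ↔ _
  rw [mul_one, one_mul, eq_comm]

end Twist

section TwistSum

variable (R : Type w) [CommRing R] {p : ℕ} {H G : Type u} [Group H] [Group G]

open Classical in
/-- The class in `R Out(G)` of the automorphism by which the right action on `x` differs from the
left action, if there is one; otherwise `0`. -/
noncomputable def twistClass (X : Biset p G G) (x : X.carrier) : MonoidAlgebra R (Out G) :=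
  if h : ∃ a : MulAut G, X.IsTwist x a then MonoidAlgebra.single (QuotientGroup.mk h.choose) 1
  else 0

theorem IsTwist.twistClass_eq {X : Biset p G G} {x : X.carrier} {a : MulAut G}
    (h : X.IsTwist x a) : X.twistClass R x = MonoidAlgebra.single (QuotientGroup.mk a) 1 := by
  have h' : ∃ a : MulAut G, X.IsTwist x a := ⟨a, h⟩
  rw [twistClass, dif_pos h', h'.choose_spec.unique h]

theorem twistClass_eq_zero {X : Biset p G G} {x : X.carrier}
    (h : ∀ a : MulAut G, ¬ X.IsTwist x a) : X.twistClass R x = 0 :=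
  dif_neg (not_exists.mpr h)

theorem twistClass_map {X Y : Biset p G G} {i : X.carrier → Y.carrier}
    (hi : Function.Injective i) (hl : ∀ (h : G) x, i (h • x) = h • i x)
    (hr : ∀ (g : G) x, i (op g • x) = op g • i x) (x : X.carrier) :
    Y.twistClass R (i x) = X.twistClass R x := by
  have h : Y.IsTwist (i x) = X.IsTwist x := funext fun a => propext (isTwist_map_iff hi hl hr)
  unfold twistClass
  rw [h]

theorem twistClass_smul (X : Biset p G G) (k : G) (x : X.carrier) :
    X.twistClass R (k • x) = X.twistClass R x := by
  by_cases h : ∃ a : MulAut G, X.IsTwist x a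
  · obtain ⟨a, ha⟩ := h
    have hk : (QuotientGroup.mk (a.trans (MulAut.conj k)) : Out G) = QuotientGroup.mk a :=
      (congrArg (· * QuotientGroup.mk a) (mk_conj_eq_one k)).trans (one_mul _)
    rw [ha.twistClass_eq R, (ha.smul k).twistClass_eq R, hk]
  · rw [twistClass_eq_zero R (not_exists.mp h), twistClass_eq_zero]
    intro a ha
    have := ha.smul k⁻¹
    rw [inv_smul_smul] at this
    exact h ⟨_, this⟩

/-- The common value of `twistClass` on a left orbit. -/
noncomputable def orbitTwistClass (X : Biset p G G) :
    MulAction.orbitRel.Quotient G X.carrier → MonoidAlgebra R (Out G) :=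
  Quotient.lift (X.twistClass R) (by rintro _ x ⟨k, rfl⟩; exact twistClass_smul R X k x)

/-- The sum of the classes of automorphisms attached to the left orbits of a biset. -/
noncomputable def twistSum (X : Biset p G G) : MonoidAlgebra R (Out G) :=
  ∑ᶠ ω, X.orbitTwistClass R ω

theorem twistSum_congr {X Y : Biset p G G} (h : X ≈ Y) : X.twistSum R = Y.twistSum R := by
  obtain ⟨f⟩ := h
  have hrel : ∀ x y : X.carrier, MulAction.orbitRel G X.carrier x y ↔
      MulAction.orbitRel G Y.carrier (f.toEquiv x) (f.toEquiv y) := fun x y =>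
    exists_congr fun k => by
      rw [← f.toEquiv.injective.eq_iff]
      exact Eq.congr_left (f.map_left k y)
  refine finsum_eq_of_bijective _ (Quotient.congr f.toEquiv hrel).bijective ?_
  rintro ⟨x⟩
  exact (twistClass_map R f.toEquiv.injective f.map_left f.map_right x).symm

theorem twistSum_empty : (empty p G G).twistSum R = 0 := by
  have : IsEmpty (MulAction.orbitRel.Quotient G (empty p G G).carrier) :=
    ⟨by rintro ⟨x⟩; exact PEmpty.elim x⟩
  exact finsum_of_isEmpty _

theorem twistSum_sum (X Y : Biset p G G) :
    (X.sum Y).twistSum R = X.twistSum R + Y.twistSum R := by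
  have : Fintype (MulAction.orbitRel.Quotient G X.carrier) := Fintype.ofFinite _
  have : Fintype (MulAction.orbitRel.Quotient G Y.carrier) := Fintype.ofFinite _
  calc (X.sum Y).twistSum R
    _ = ∑ᶠ ω, Sum.elim (X.orbitTwistClass R) (Y.orbitTwistClass R) ω := by
        refine finsum_eq_of_bijective _
          (orbitRelQuotientSumEquiv G X.carrier Y.carrier).bijective ?_
        rintro ⟨x | y⟩
        · exact twistClass_map R (Y := X.sum Y) Sum.inl_injective (fun _ _ => rfl)
            (fun _ _ => rfl) x
        · exact twistClass_map R (Y := X.sum Y) Sum.inr_injective (fun _ _ => rfl)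
            (fun _ _ => rfl) y
    _ = X.twistSum R + Y.twistSum R := by
        rw [finsum_eq_sum_of_fintype, Fintype.sum_sum_type]
        simp only [twistSum, finsum_eq_sum_of_fintype, Sum.elim_inl, Sum.elim_inr]

theorem twistSum_ofIso [Fact p.Prime] [Finite G] (a : MulAut G) :
    (ofIso p a).twistSum R = MonoidAlgebra.single (QuotientGroup.mk a) 1 := by
  let _ : Unique (MulAction.orbitRel.Quotient G (ofIso p a).carrier) :=
    { default := Quotient.mk _ (1 : G)
      uniq := by
        rintro ⟨x⟩
        exact Quotient.sound ⟨(show G from x), mul_one (show G from x)⟩ }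
  exact (finsum_unique _).trans ((isTwist_ofIso_one a).twistClass_eq R)

theorem twistSum_comp_of_card_lt [Fact p.Prime] [Finite H] [Finite G]
    (hc : Nat.card H < Nat.card G) (Y : Biset p G H) (Z : Biset p H G) :
    (Y.comp Z).twistSum R = 0 := by
  refine (finsum_congr ?_).trans finsum_zero
  rintro ⟨x⟩
  exact twistClass_eq_zero R fun a ha => hc.not_ge ha.card_le

end TwistSum

end Biset

namespace RB

variable {p : ℕ} {H G : Type u} [Group H] [Group G] (R : Type w) [CommRing R]

variable (p G) in
/-- The linear extension of `Biset.twistSum` to `R B^Δ(G, G)`. -/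
noncomputable def twistSum : RB p G G R →ₗ[R] MonoidAlgebra R (Out G) :=
  LinearMap.liftBaseChange R (AddMonoidHom.toIntLinearMap
    (Algebra.GrothendieckAddGroup.lift
      { toFun := Quotient.lift (fun X : Biset p G G => X.twistSum R)
          fun _ _ h => Biset.twistSum_congr R h
        map_zero' := Biset.twistSum_empty R
        map_add' := by
          rintro ⟨X⟩ ⟨Y⟩
          exact Biset.twistSum_sum R X Y }))

theorem twistSum_mk (X : Biset p G G) : twistSum p G R (mk R X) = X.twistSum R := by
  simp only [twistSum, mk, LinearMap.liftBaseChange_tmul, one_smul,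
    AddMonoidHom.coe_toIntLinearMap, BurnsideGroup.lift_mk]
  rfl

theorem twistSum_comp_of_card_lt [Fact p.Prime] [Finite H] [Finite G]
    (hc : Nat.card H < Nat.card G) (y : RB p G H R) (z : RB p H G R) :
    twistSum p G R (comp R y z) = 0 := by
  have h : (comp R : RB p G H R →ₗ[R] RB p H G R →ₗ[R] RB p G G R).compr₂ (twistSum p G R) = 0 :=
    hom_ext fun Y => hom_ext fun Z => by
      rw [LinearMap.compr₂_apply, comp_mk, twistSum_mk, Biset.twistSum_comp_of_card_lt R hc]
      rfl
  exact LinearMap.congr_fun₂ h y z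

end RB

/-! ### The essential algebra -/

namespace RB

variable {R : Type w} [CommRing R] {p : ℕ} {H G : Type u} [Group H] [Group G]

theorem mk_sum (X Y : Biset p H G) : mk R (X.sum Y) = mk R X + mk R Y := by
  have h : BurnsideGroup.mk (X.sum Y) = BurnsideGroup.mk X + BurnsideGroup.mk Y :=
    map_add Algebra.GrothendieckAddGroup.of (BisetClass.mk X) (BisetClass.mk Y)
  rw [mk, h, TensorProduct.tmul_add]
  rfl

theorem mk_of_isEmpty (X : Biset p H G) [IsEmpty X.carrier] : mk R X = 0 := by
  have : IsEmpty (Biset.empty p H G).carrier := inferInstanceAs (IsEmpty PEmpty)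
  have h : X ≈ Biset.empty p H G :=
    ⟨⟨Equiv.equivOfIsEmpty _ _, fun _ x => isEmptyElim x, fun _ x => isEmptyElim x⟩⟩
  rw [mk_eq R h, mk,
    show BurnsideGroup.mk (Biset.empty p H G) = 0 from map_zero Algebra.GrothendieckAddGroup.of,
    TensorProduct.tmul_zero]

theorem mk_mem_of_transitive_mem {M : Submodule R (RB p H G R)}
    (hM : ∀ (X : Biset p H G) (x : X.carrier), X.biorbit x = Set.univ → mk R X ∈ M)
    (X : Biset p H G) : mk R X ∈ M := by
  induction hn : Nat.card X.carrier using Nat.strong_induction_on generalizing X with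
  | _ n ih =>
    subst hn
    rcases isEmpty_or_nonempty X.carrier with hX | ⟨⟨x⟩⟩
    · rw [mk_of_isEmpty]
      exact M.zero_mem
    · have hx : x ∈ X.biorbit x := ⟨1, 1, by rw [op_one, one_smul, one_smul]⟩
      rw [← mk_eq R (X.sub_sum_sub_compl (X.biorbit x) (X.smul_mem_biorbit x)
        (X.op_smul_mem_biorbit x)), mk_sum]
      refine M.add_mem (hM _ ⟨x, hx⟩ (Set.eq_univ_of_forall ?_)) (ih _ ?_ _ rfl)
      · rintro ⟨_, h, g, rfl⟩
        exact ⟨h, g, rfl⟩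
      · exact Finite.card_subtype_lt (p := fun y => y ∈ (X.biorbit x)ᶜ) (x := x) fun h => h hx

theorem eq_top_of_transitive_mem {M : Submodule R (RB p H G R)}
    (hM : ∀ (X : Biset p H G) (x : X.carrier), X.biorbit x = Set.univ → mk R X ∈ M) : M = ⊤ := by
  have h : M.mkQ = 0 := hom_ext fun X => by
    rw [Submodule.mkQ_apply, LinearMap.zero_apply, Submodule.Quotient.mk_eq_zero]
    exact mk_mem_of_transitive_mem hM X
  rw [← M.ker_mkQ, h, LinearMap.ker_zero]

end RB

section Essential

variable {R : Type w} [CommRing R] {p : ℕ} [Fact p.Prime]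

namespace BisetCat

variable {G H K : BisetCat.{u, w} R p}

theorem homOfBiset_comp (X : Biset p H.carrier G.carrier) (Y : Biset p K.carrier H.carrier) :
    homOfBiset X ≫ homOfBiset Y = (homOfBiset (Y.comp X) : G ⟶ K) :=
  RB.comp_mk R Y X

theorem homOfBiset_eq {X Y : Biset p H.carrier G.carrier} (h : X ≈ Y) :
    (homOfBiset X : G ⟶ H) = homOfBiset Y :=
  RB.mk_eq R h

variable (R) in
/-- The morphism of `R C^Δ` given by a group isomorphism. -/
noncomputable abbrev homOfIso (f : G.carrier ≃* H.carrier) : G ⟶ H :=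
  homOfBiset (Biset.ofIso p f)

theorem homOfIso_comp (f : G.carrier ≃* H.carrier) (g : H.carrier ≃* K.carrier) :
    homOfIso R f ≫ homOfIso R g = homOfIso R (f.trans g) :=
  (homOfBiset_comp _ _).trans (homOfBiset_eq (Biset.ofIso_comp_ofIso g f))

theorem homOfIso_refl (G : BisetCat.{u, w} R p) : homOfIso R (MulEquiv.refl G.carrier) = 𝟙 G :=
  rfl

/-- The isomorphism of `R C^Δ` given by a group isomorphism. -/
noncomputable def isoOfMulEquiv (f : G.carrier ≃* H.carrier) : G ≅ H where
  hom := homOfIso R f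
  inv := homOfIso R f.symm
  hom_inv_id := by rw [homOfIso_comp, MulEquiv.self_trans_symm, homOfIso_refl]
  inv_hom_id := by rw [homOfIso_comp, MulEquiv.symm_trans_self, homOfIso_refl]

/-- The submodule of the morphisms generated by those which factor through a group of order
smaller than that of the source. -/
noncomputable def factoring (G H : BisetCat.{u, w} R p) : Submodule R (G ⟶ H) :=
  Submodule.span R {f | ∃ (K : BisetCat.{u, w} R p) (x : G ⟶ K) (y : K ⟶ H),
    Nat.card K.carrier < Nat.card G.carrier ∧ f = x ≫ y}

theorem factoring_le_iff {M : Submodule R (G ⟶ H)} :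
    factoring G H ≤ M ↔ ∀ (K : BisetCat.{u, w} R p) (x : G ⟶ K) (y : K ⟶ H),
      Nat.card K.carrier < Nat.card G.carrier → x ≫ y ∈ M := by
  refine Submodule.span_le.trans ⟨fun h K x y hK => h ⟨K, x, y, hK, rfl⟩, ?_⟩
  rintro h _ ⟨K, x, y, hK, rfl⟩
  exact h K x y hK

theorem comp_mem_factoring {x : G ⟶ H} (hx : x ∈ factoring G H) (y : H ⟶ K) :
    x ≫ y ∈ factoring G K := by
  have h : factoring G H ≤ (factoring G K).comap (Linear.rightComp R G y) :=
    factoring_le_iff.mpr fun L a b hL =>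
      Submodule.subset_span ⟨L, a, b ≫ y, hL, Category.assoc a b y⟩
  exact h hx

theorem comp_mem_factoring_of_card_le (hc : Nat.card H.carrier ≤ Nat.card G.carrier) (x : G ⟶ H)
    {y : H ⟶ K} (hy : y ∈ factoring H K) : x ≫ y ∈ factoring G K := by
  have h : factoring H K ≤ (factoring G K).comap (Linear.leftComp R K x) :=
    factoring_le_iff.mpr fun L a b hL =>
      Submodule.subset_span ⟨L, x ≫ a, b, hL.trans_le hc, (Category.assoc x a b).symm⟩
  exact h hy

theorem span_homOfIso_sup_factoring (hc : Nat.card H.carrier ≤ Nat.card G.carrier) :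
    Submodule.span R (Set.range fun f : G.carrier ≃* H.carrier => (homOfIso R f : G ⟶ H)) ⊔
      factoring G H = ⊤ := by
  refine RB.eq_top_of_transitive_mem fun X x hx => ?_
  obtain ⟨Q, _, _, Y, Z, hQ, h⟩ | ⟨f, hf⟩ :=
    Biset.factorsThroughSmaller_or_exists_ofIso_equiv hc hx
  · refine Submodule.mem_sup_right (Submodule.subset_span ?_)
    refine ⟨⟨Q⟩, homOfBiset Z, homOfBiset Y, hQ, ?_⟩
    rw [homOfBiset_comp]
    exact (homOfBiset_eq h).symm
  · exact Submodule.mem_sup_left (Submodule.subset_span ⟨f, homOfBiset_eq hf⟩)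

theorem factoring_eq_top_of_isEmpty (hc : Nat.card H.carrier ≤ Nat.card G.carrier)
    [IsEmpty (G.carrier ≃* H.carrier)] : factoring G H = ⊤ := by
  have h := span_homOfIso_sup_factoring hc
  rwa [Set.range_eq_empty, Submodule.span_empty, bot_sup_eq] at h

theorem linearMap_eq_of_homOfIso {A : Type*} [AddCommGroup A] [Module R A]
    {φ ψ : (G ⟶ H) →ₗ[R] A} (hc : Nat.card H.carrier ≤ Nat.card G.carrier)
    (hiso : ∀ f : G.carrier ≃* H.carrier, φ (homOfIso R f) = ψ (homOfIso R f))
    (hfac : factoring G H ≤ LinearMap.eqLocus φ ψ) : φ = ψ := by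
  rw [← LinearMap.eqLocus_eq_top, eq_top_iff, ← span_homOfIso_sup_factoring hc]
  refine sup_le (Submodule.span_le.mpr ?_) hfac
  rintro _ ⟨f, rfl⟩
  exact hiso f

end BisetCat

open BisetCat

variable (G : BisetCat.{u, w} R p)

/-- The homomorphism sending an automorphism of `G` to its biset. -/
noncomputable def mulAutToEnd : MulAut G.carrier →* End G where
  toFun a := homOfIso R a
  map_one' := homOfIso_refl G
  map_mul' a b := (homOfIso_comp b a).symm

/-- The homomorphism sending the class of an automorphism to the class of its biset. -/
noncomputable def outToEssential : Out G.carrier →* EssentialAlgebra G :=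
  QuotientGroup.lift _
    ((Ideal.Quotient.mk (essentialIdeal G)).toMonoidHom.comp (mulAutToEnd G)) (by
    rintro _ ⟨g, rfl⟩
    have h : mulAutToEnd G (MulAut.conj g) = 1 := homOfBiset_eq (Biset.ofIso_conj g)
    rw [MonoidHom.mem_ker, MonoidHom.comp_apply, h, map_one])

/-- The algebra homomorphism `R Out(G) → E^Δ(G)`. -/
noncomputable def outAlgebraToEssential :
    MonoidAlgebra R (Out G.carrier) →ₐ[R] EssentialAlgebra G :=
  MonoidAlgebra.lift R _ _ (outToEssential G)

theorem outAlgebraToEssential_single (a : MulAut G.carrier) :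
    outAlgebraToEssential G (MonoidAlgebra.single (QuotientGroup.mk a) 1) =
      Ideal.Quotient.mk (essentialIdeal G) (homOfIso R a) := by
  rw [outAlgebraToEssential, MonoidAlgebra.lift_single, one_smul]
  rfl

/-- The linear map `E^Δ(G) → R Out(G)` induced by `RB.twistSum`. -/
noncomputable def essentialToOut : EssentialAlgebra G →ₗ[R] MonoidAlgebra R (Out G.carrier) :=
  (factoring G G).liftQ (RB.twistSum p G.carrier R)
    (factoring_le_iff.mpr fun _ x y h => RB.twistSum_comp_of_card_lt R h y x)

theorem essentialToOut_homOfIso (a : MulAut G.carrier) :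
    essentialToOut G (Ideal.Quotient.mk (essentialIdeal G) (homOfIso R a)) =
      MonoidAlgebra.single (QuotientGroup.mk a) 1 :=
  (RB.twistSum_mk R _).trans (Biset.twistSum_ofIso R a)

theorem essentialToOut_outAlgebraToEssential (z : MonoidAlgebra R (Out G.carrier)) :
    essentialToOut G (outAlgebraToEssential G z) = z := by
  have h : essentialToOut G ∘ₗ (outAlgebraToEssential G).toLinearMap = LinearMap.id := by
    refine MonoidAlgebra.lhom_ext' fun α => LinearMap.ext_ring ?_
    obtain ⟨a, rfl⟩ := QuotientGroup.mk_surjective α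
    exact (congrArg _ (outAlgebraToEssential_single G a)).trans (essentialToOut_homOfIso G a)
  exact DFunLike.congr_fun h z

theorem outAlgebraToEssential_essentialToOut (z : EssentialAlgebra G) :
    outAlgebraToEssential G (essentialToOut G z) = z := by
  let π : (G ⟶ G) →ₗ[R] EssentialAlgebra G := (Ideal.Quotient.mkₐ R (essentialIdeal G)).toLinearMap
  have h : (outAlgebraToEssential G).toLinearMap ∘ₗ essentialToOut G ∘ₗ π = π := by
    refine linearMap_eq_of_homOfIso le_rfl (fun a => ?_) fun x hx => ?_
    · exact (congrArg _ (essentialToOut_homOfIso G a)).trans (outAlgebraToEssential_single G a)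
    · have hπ : π x = 0 := Ideal.Quotient.eq_zero_iff_mem.mpr hx
      change outAlgebraToEssential G (essentialToOut G (π x)) = π x
      rw [hπ, map_zero, map_zero]
  obtain ⟨x, rfl⟩ := Ideal.Quotient.mk_surjective z
  exact DFunLike.congr_fun h x

/-- The isomorphism `E^Δ(G) ≃ R Out(G)`. -/
noncomputable def essentialEquiv : EssentialAlgebra G ≃ₐ[R] MonoidAlgebra R (Out G.carrier) :=
  AlgEquiv.symm
    { outAlgebraToEssential G with
      invFun := essentialToOut G
      left_inv := essentialToOut_outAlgebraToEssential G
      right_inv := outAlgebraToEssential_essentialToOut G }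

theorem essentialEquiv_homOfIso (a : MulAut G.carrier) :
    essentialEquiv G (Ideal.Quotient.mk (essentialIdeal G) (homOfIso R a)) =
      MonoidAlgebra.single (QuotientGroup.mk a) 1 :=
  essentialToOut_homOfIso G a

/-- The projection `End(G) → R Out(G)` through the essential algebra. -/
noncomputable def endToOut : End G →ₐ[R] MonoidAlgebra R (Out G.carrier) :=
  (essentialEquiv G).toAlgHom.comp (Ideal.Quotient.mkₐ R (essentialIdeal G))

theorem endToOut_surjective : Function.Surjective (endToOut G) :=
  (essentialEquiv G).surjective.comp Ideal.Quotient.mk_surjective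

variable {G}

theorem endToOut_eq_zero_iff {x : End G} : endToOut G x = 0 ↔ x ∈ essentialIdeal G :=
  (map_eq_zero_iff _ (essentialEquiv G).injective).trans Ideal.Quotient.eq_zero_iff_mem

theorem endToOut_conj {H : BisetCat.{u, w} R p} (f : G.carrier ≃* H.carrier) (x : G ⟶ G) :
    endToOut H (homOfIso R f.symm ≫ x ≫ homOfIso R f : H ⟶ H) =
      MonoidAlgebra.domCongr R R (outCongr f) (endToOut G x) := by
  let φ : (G ⟶ G) →ₗ[R] MonoidAlgebra R (Out H.carrier) :=
    (endToOut H).toLinearMap ∘ₗ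
      Linear.leftComp R H (homOfIso R f.symm) ∘ₗ Linear.rightComp R G (homOfIso R f)
  let ψ : (G ⟶ G) →ₗ[R] MonoidAlgebra R (Out H.carrier) :=
    (MonoidAlgebra.domCongr R R (outCongr f)).toLinearMap ∘ₗ (endToOut G).toLinearMap
  suffices h : φ = ψ from DFunLike.congr_fun h x
  refine linearMap_eq_of_homOfIso le_rfl (fun a => ?_) fun y hy => ?_
  · have hconj : homOfIso R f.symm ≫ homOfIso R a ≫ homOfIso R f =
        (homOfIso R (MulAut.congr f a) : H ⟶ H) := by
      rw [homOfIso_comp, homOfIso_comp]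
      rfl
    change endToOut H (homOfIso R f.symm ≫ homOfIso R a ≫ homOfIso R f : H ⟶ H) =
      MonoidAlgebra.domCongr R R (outCongr f) (essentialEquiv G (Ideal.Quotient.mk _ _))
    rw [hconj, essentialEquiv_homOfIso, MonoidAlgebra.domCongr_single]
    exact essentialEquiv_homOfIso H _
  · have hφ : φ y = 0 := endToOut_eq_zero_iff.mpr <|
      comp_mem_factoring_of_card_le (Nat.card_congr f.toEquiv).le _ (comp_mem_factoring hy _)
    have hψ : ψ y = 0 := by
      rw [LinearMap.comp_apply, show (endToOut G).toLinearMap y = 0 from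
        endToOut_eq_zero_iff.mpr hy, map_zero]
    exact hφ.trans hψ.symm

end Essential

/-! ### Simple linear functors -/

section LinearFunctors

universe v v₁ u₁

/-- The category of `R`-linear functors from `C` to `R`-modules; for `C = R C^Δ` it is
`BisetFunctor R p`. -/
abbrev LinearFunctor (R : Type w) [CommRing R] (C : Type u₁) [Category.{v₁} C] [Preadditive C]
    [Linear R C] :=
  ObjectProperty.FullSubcategory fun F : C ⥤ ModuleCat.{v} R => F.Additive ∧ F.Linear R

variable {R : Type w} [CommRing R]

/-- An `A`-module `V`, given by an algebra morphism `ρ : A → End_R(V)`, is irreducible if it is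
nonzero and has no proper nonzero `A`-submodule. -/
def IsIrreducible {A V : Type*} [Semiring A] [Algebra R A] [AddCommGroup V] [Module R V]
    (ρ : A →ₐ[R] Module.End R V) : Prop :=
  Nontrivial V ∧ ∀ W : Submodule R V, (∀ a, ∀ v ∈ W, ρ a v ∈ W) → W = ⊥ ∨ W = ⊤

namespace LinearFunctor

variable {C : Type u₁} [Category.{v₁} C] [Preadditive C] [Linear R C]
  (F F' : LinearFunctor.{w, v} R C)

theorem map_add {K L : C} (f g : K ⟶ L) : F.obj.map (f + g) = F.obj.map f + F.obj.map g :=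
  F.property.1.map_add

theorem map_smul {K L : C} (r : R) (f : K ⟶ L) : F.obj.map (r • f) = r • F.obj.map f :=
  F.property.2.map_smul f r

theorem map_id_apply {K : C} (z : F.obj.obj K) : F.obj.map (𝟙 K) z = z :=
  congrArg (fun h => h.hom z) (F.obj.map_id K)

theorem map_comp_apply {K L M : C} (f : K ⟶ L) (g : L ⟶ M) (z : F.obj.obj K) :
    F.obj.map (f ≫ g) z = F.obj.map g (F.obj.map f z) :=
  congrArg (fun h => h.hom z) (F.obj.map_comp f g)

/-- The action of `End(G)` on the value of a linear functor at `G`. -/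
noncomputable def action (G : C) : End G →ₐ[R] Module.End R (F.obj.obj G) :=
  AlgHom.ofLinearMap
    { toFun := fun x => (F.obj.map x.asHom).hom
      map_add' := fun x y => congrArg (·.hom) (F.map_add x.asHom y.asHom)
      map_smul' := fun r x => congrArg (·.hom) (F.map_smul r x.asHom) }
    (congrArg (·.hom) (F.obj.map_id G))
    (fun x y => congrArg (·.hom) (F.obj.map_comp y.asHom x.asHom))

/-- A family of submodules of the values of a functor which is stable under all morphisms. -/
def IsStable (N : ∀ K, Submodule R (F.obj.obj K)) : Prop :=
  ∀ ⦃K L : C⦄ (f : K ⟶ L) (z : F.obj.obj K), z ∈ N K → F.obj.map f z ∈ N L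

/-- A linear functor is generated at `G` if its values are spanned by the images of elements of
its value at `G`. -/
def IsGeneratedAt (G : C) : Prop :=
  ∀ K, ⨆ x : G ⟶ K, LinearMap.range (F.obj.map x).hom = ⊤

/-- A linear functor is cogenerated at `G` if the morphisms to `G` separate the elements of its
values. -/
def IsCogeneratedAt (G : C) : Prop :=
  ∀ K, ⨅ y : K ⟶ G, LinearMap.ker (F.obj.map y).hom = ⊥

variable {F F'}

section Subfunctors

variable {N : ∀ K, Submodule R (F.obj.obj K)}

/-- The subfunctor given by a stable family of submodules. -/
def subfunctor (hN : F.IsStable N) : LinearFunctor.{w, v} R C where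
  obj :=
    { obj := fun K => ModuleCat.of R (N K)
      map := fun f => ModuleCat.ofHom ((F.obj.map f).hom.restrict (hN f))
      map_id := fun _ => ModuleCat.hom_ext (LinearMap.ext fun z =>
        Subtype.ext (F.map_id_apply z.1))
      map_comp := fun f g => ModuleCat.hom_ext (LinearMap.ext fun z =>
        Subtype.ext (F.map_comp_apply f g z.1)) }
  property :=
    ⟨⟨fun {_ _ f g} => ModuleCat.hom_ext (LinearMap.ext fun z =>
      Subtype.ext (congrArg (fun h => h.hom z.1) (F.map_add f g)))⟩,
    ⟨fun f r => ModuleCat.hom_ext (LinearMap.ext fun z =>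
      Subtype.ext (congrArg (fun h => h.hom z.1) (F.map_smul r f)))⟩⟩

/-- The inclusion of a subfunctor. -/
def subfunctorι (hN : F.IsStable N) : subfunctor hN ⟶ F where
  hom :=
    { app := fun K => ModuleCat.ofHom (N K).subtype
      naturality := fun _ _ _ => rfl }

end Subfunctors

section Morphisms

theorem naturality_apply (f : F ⟶ F') {K L : C} (x : K ⟶ L) (z : F.obj.obj K) :
    f.hom.app L (F.obj.map x z) = F'.obj.map x (f.hom.app K z) :=
  congrArg (fun h => h.hom z) (f.hom.naturality x)

theorem hom_eq_zero_iff {f : F ⟶ F'} : f = 0 ↔ ∀ K z, f.hom.app K z = 0 := by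
  constructor
  · rintro rfl K z
    rfl
  · intro h
    ext K z
    exact h K z

theorem mono_of_injective (f : F ⟶ F') (hf : ∀ K, Function.Injective (f.hom.app K)) : Mono f where
  right_cancellation g h e := by
    ext K z
    exact hf K (congrArg (fun t => t.hom.app K z) e)

theorem injective_of_mono (f : F ⟶ F') [Mono f] (K : C) : Function.Injective (f.hom.app K) := by
  have hN : F.IsStable fun K => LinearMap.ker (f.hom.app K).hom := by
    intro K L x _ hz
    exact (naturality_apply f x _).trans ((congrArg _ hz).trans (_root_.map_zero _))
  have h0 : subfunctorι hN = 0 := by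
    rw [← cancel_mono f, Limits.zero_comp, hom_eq_zero_iff]
    rintro L ⟨_, hz⟩
    exact hz
  refine (injective_iff_map_eq_zero (f.hom.app K).hom).mpr fun z hz => ?_
  exact hom_eq_zero_iff.mp h0 K ⟨z, hz⟩

theorem isIso_of_bijective (f : F ⟶ F') (hf : ∀ K, Function.Bijective (f.hom.app K)) :
    IsIso f := by
  have happ : ∀ K, IsIso (f.hom.app K) := fun K =>
    (ConcreteCategory.isIso_iff_bijective (f.hom.app K)).mpr (hf K)
  have : IsIso ((ObjectProperty.ι _).map f) := NatIso.isIso_of_isIso_app f.hom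
  exact isIso_of_fully_faithful (ObjectProperty.ι _) f

theorem bijective_of_isIso (f : F ⟶ F') [IsIso f] (K : C) : Function.Bijective (f.hom.app K) := by
  have : IsIso f.hom := inferInstanceAs (IsIso ((ObjectProperty.ι _).map f))
  exact (ConcreteCategory.isIso_iff_bijective (f.hom.app K)).mp inferInstance

end Morphisms

section Simple

theorem exists_nontrivial [Simple F] : ∃ K, Nontrivial (F.obj.obj K) := by
  by_contra! h
  refine id_nonzero F (hom_eq_zero_iff.mpr fun K z => ?_)
  exact (h K).elim _ _

theorem IsStable.eq_bot_or_eq_top [Simple F] {N : ∀ K, Submodule R (F.obj.obj K)}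
    (hN : F.IsStable N) : N = ⊥ ∨ N = ⊤ := by
  have : Mono (subfunctorι hN) := mono_of_injective _ fun K => Subtype.val_injective
  by_cases h : subfunctorι hN = 0
  · refine .inl (funext fun K => (Submodule.eq_bot_iff _).mpr fun z hz => ?_)
    exact hom_eq_zero_iff.mp h K ⟨z, hz⟩
  · have : IsIso (subfunctorι hN) := isIso_of_mono_of_nonzero h
    refine .inr (funext fun K => Submodule.eq_top_iff'.mpr fun z => ?_)
    obtain ⟨y, rfl⟩ := (bijective_of_isIso (subfunctorι hN) K).2 z
    exact y.2

theorem simple_of_isStable {G : C} [Nontrivial (F.obj.obj G)]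
    (h : ∀ N, F.IsStable N → N = ⊥ ∨ N = ⊤) : Simple F where
  mono_isIso_iff_nonzero {Y} f _ := by
    constructor
    · rintro hf rfl
      obtain ⟨z, hz⟩ := exists_ne (0 : F.obj.obj G)
      obtain ⟨y, hy⟩ := (bijective_of_isIso (0 : Y ⟶ F) G).2 z
      exact hz hy.symm
    · intro hf
      have hN : F.IsStable fun K => LinearMap.range (f.hom.app K).hom := by
        rintro K L x _ ⟨y, rfl⟩
        exact ⟨Y.obj.map x y, naturality_apply f x y⟩
      obtain hbot | htop := h _ hN
      · refine absurd (hom_eq_zero_iff.mpr fun K z => ?_) hf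
        exact LinearMap.congr_fun (LinearMap.range_eq_bot.mp (congrFun hbot K)) z
      · exact isIso_of_bijective f fun K =>
          ⟨injective_of_mono f K, LinearMap.range_eq_top.mp (congrFun htop K)⟩

variable {G : C}

theorem isStable_iSup_range :
    F.IsStable fun K => ⨆ x : G ⟶ K, LinearMap.range (F.obj.map x).hom := by
  intro K L f z hz
  have h : ⨆ x : G ⟶ K, LinearMap.range (F.obj.map x).hom ≤
      (⨆ x : G ⟶ L, LinearMap.range (F.obj.map x).hom).comap (F.obj.map f).hom := by
    refine iSup_le fun x => ?_
    rintro _ ⟨v, rfl⟩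
    exact Submodule.mem_iSup_of_mem (x ≫ f) ⟨v, F.map_comp_apply x f v⟩
  exact h hz

theorem isStable_iInf_comap (W : Submodule R (F.obj.obj G)) :
    F.IsStable fun K => ⨅ y : K ⟶ G, W.comap (F.obj.map y).hom := by
  intro K L f z hz
  simp only [Submodule.mem_iInf, Submodule.mem_comap] at hz ⊢
  intro y
  have h := hz (f ≫ y)
  rwa [F.obj.map_comp] at h

theorem iInf_comap_end_eq {W : Submodule R (F.obj.obj G)}
    (hW : ∀ (x : End G), ∀ v ∈ W, F.action G x v ∈ W) :
    ⨅ y : G ⟶ G, W.comap (F.obj.map y).hom = W := by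
  refine le_antisymm (iInf_le_of_le (𝟙 G) ?_) (le_iInf hW)
  rw [F.obj.map_id]
  exact le_rfl

theorem IsGeneratedAt.eq_top (h : F.IsGeneratedAt G) {K : C} {N : Submodule R (F.obj.obj K)}
    (hN : ∀ (x : G ⟶ K) v, F.obj.map x v ∈ N) : N = ⊤ := by
  refine top_le_iff.mp ((h K).ge.trans (iSup_le fun x => ?_))
  rintro _ ⟨v, rfl⟩
  exact hN x v

theorem IsCogeneratedAt.eq_zero (h : F.IsCogeneratedAt G) {K : C} {z : F.obj.obj K}
    (hz : ∀ y : K ⟶ G, F.obj.map y z = 0) : z = 0 :=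
  (Submodule.mem_bot R).mp (h K ▸ (Submodule.mem_iInf _).mpr hz)

theorem simple_of_isIrreducible_action (hgen : F.IsGeneratedAt G) (hcogen : F.IsCogeneratedAt G)
    (hirr : IsIrreducible (F.action G)) : Simple F := by
  have := hirr.1
  refine simple_of_isStable (G := G) fun N hN => ?_
  obtain hbot | htop := hirr.2 (N G) fun x v hv => hN x v hv
  · refine .inl (funext fun K => (Submodule.eq_bot_iff _).mpr fun z hz => ?_)
    exact hcogen.eq_zero fun y => (Submodule.mem_bot R).mp (hbot ▸ hN y z hz)
  · exact .inr (funext fun K => hgen.eq_top fun x v => hN x v (htop ▸ Submodule.mem_top))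

theorem exists_map_comp_ne_zero (hgen : F.IsGeneratedAt G) (hcogen : F.IsCogeneratedAt G) {K : C}
    [Nontrivial (F.obj.obj K)] : ∃ (x : G ⟶ K) (y : K ⟶ G), F.obj.map (x ≫ y) ≠ 0 := by
  by_contra! h
  have htop : (⊥ : Submodule R (F.obj.obj K)) = ⊤ := hgen.eq_top fun x v =>
    (Submodule.mem_bot R).mpr <| hcogen.eq_zero fun y => by
      rw [← F.map_comp_apply, h]
      rfl
  exact bot_ne_top htop

variable [Simple F] [Nontrivial (F.obj.obj G)]

theorem isGeneratedAt_of_simple : F.IsGeneratedAt G := by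
  obtain hbot | htop := (isStable_iSup_range (F := F) (G := G)).eq_bot_or_eq_top
  · obtain ⟨v, hv⟩ := exists_ne (0 : F.obj.obj G)
    have hmem : v ∈ ⨆ x : G ⟶ G, LinearMap.range (F.obj.map x).hom :=
      Submodule.mem_iSup_of_mem (𝟙 G) ⟨v, F.map_id_apply v⟩
    have hG : ⨆ x : G ⟶ G, LinearMap.range (F.obj.map x).hom = ⊥ := congrFun hbot G
    rw [hG] at hmem
    exact absurd ((Submodule.mem_bot R).mp hmem) hv
  · exact congrFun htop

theorem isIrreducible_action_of_simple : IsIrreducible (F.action G) := by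
  refine ⟨inferInstance, fun W hW => ?_⟩
  rw [← iInf_comap_end_eq hW]
  exact (F.isStable_iInf_comap W).eq_bot_or_eq_top.imp (congrFun · G) (congrFun · G)

theorem isCogeneratedAt_of_simple : F.IsCogeneratedAt G := by
  have hG := iInf_comap_end_eq (F := F) (G := G) (W := ⊥) fun x v hv => by
    rw [(Submodule.mem_bot R).mp hv, _root_.map_zero]
    exact Submodule.zero_mem _
  obtain hbot | htop := (F.isStable_iInf_comap (⊥ : Submodule R (F.obj.obj G))).eq_bot_or_eq_top
  · exact congrFun hbot
  · exact absurd (hG.symm.trans (congrFun htop G)) bot_ne_top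

end Simple

section Intertwining

variable {G : C}

/-- An isomorphism of `V` with the value of `F` at `G` under which the action of `End(G)` on `V`
given by `ρ` corresponds to its action on `F(G)`. -/
def Intertwines (F : LinearFunctor.{w, v} R C) {G : C} {V : Type*} [AddCommGroup V] [Module R V]
    (ρ : End G →ₐ[R] Module.End R V) (u : V ≃ₗ[R] F.obj.obj G) : Prop :=
  ∀ (x : G ⟶ G) (v : V), F.obj.map x (u v) = u (ρ x v)

section

variable {V : Type*} [AddCommGroup V] [Module R V] {ρ : End G →ₐ[R] Module.End R V}
  {u : V ≃ₗ[R] F.obj.obj G} (hu : F.Intertwines ρ u)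
include hu

theorem Intertwines.isIrreducible_action (hρ : IsIrreducible ρ) : IsIrreducible (F.action G) := by
  have := hρ.1
  refine ⟨u.symm.toEquiv.nontrivial, fun W hW => ?_⟩
  have hcomap := hρ.2 (W.comap u.toLinearMap) fun x v hv => by
    have h := hW x (u v) hv
    rwa [show F.action G x (u v) = u (ρ x v) from hu x v] at h
  exact hcomap.imp
    (fun h => Submodule.comap_injective_of_surjective u.surjective (h.trans u.ker.symm))
    (fun h => Submodule.comap_injective_of_surjective u.surjective h)

theorem Intertwines.map_eq_zero {x : G ⟶ G} (hx : ρ x = 0) : F.obj.map x = 0 := by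
  refine ModuleCat.hom_ext (LinearMap.ext fun z => ?_)
  obtain ⟨v, rfl⟩ := u.surjective z
  rw [hu, hx]
  exact map_zero u

theorem Intertwines.trans_iso (j : F ≅ F') :
    F'.Intertwines ρ (u.trans (LinearEquiv.ofBijective (j.hom.hom.app G).hom
      (bijective_of_isIso j.hom G))) := fun x v => by
  change F'.obj.map x (j.hom.hom.app G (u v)) = j.hom.hom.app G (u (ρ x v))
  rw [← naturality_apply, hu]

variable {H : C} (i : G ≅ H) {V' : Type*} [AddCommGroup V'] [Module R V']
  {ρ' : End H →ₐ[R] Module.End R V'}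

theorem Intertwines.trans_mapIso {t : V ≃ₗ[R] V'}
    (ht : ∀ (x : G ⟶ G) v, t (ρ x v) = ρ' (i.inv ≫ x ≫ i.hom : H ⟶ H) (t v)) :
    F.Intertwines ρ' (t.symm ≪≫ₗ u ≪≫ₗ (F.obj.mapIso i).toLinearEquiv) := fun x v => by
  obtain ⟨v, rfl⟩ := t.surjective v
  have hx : i.inv ≫ (i.hom ≫ x ≫ i.inv) ≫ i.hom = x := by
    simp only [Category.assoc, Iso.inv_hom_id_assoc, Iso.inv_hom_id, Category.comp_id]
  have htx := ht (i.hom ≫ x ≫ i.inv) v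
  rw [hx] at htx
  rw [← htx]
  simp only [LinearEquiv.trans_apply, LinearEquiv.symm_apply_apply]
  change F.obj.map x (F.obj.map i.hom (u v)) = F.obj.map i.hom (u (ρ _ v))
  rw [← hu, ← F.map_comp_apply, ← F.map_comp_apply, Category.assoc, Category.assoc,
    Iso.inv_hom_id, Category.comp_id]

theorem Intertwines.exists_equiv {u' : V' ≃ₗ[R] F.obj.obj H} (hu' : F.Intertwines ρ' u') :
    ∃ t : V ≃ₗ[R] V', ∀ (x : G ⟶ G) v, t (ρ x v) = ρ' (i.inv ≫ x ≫ i.hom : H ⟶ H) (t v) := by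
  let t : V ≃ₗ[R] V' := u ≪≫ₗ (F.obj.mapIso i).toLinearEquiv ≪≫ₗ u'.symm
  have ht : ∀ v, u' (t v) = F.obj.map i.hom (u v) := fun v => u'.apply_symm_apply _
  refine ⟨t, fun x v => u'.injective ?_⟩
  rw [← hu', ht, ht, ← hu, ← F.map_comp_apply, ← F.map_comp_apply, Iso.hom_inv_id_assoc]

end


theorem exists_hom_app_eq (hF : F.IsGeneratedAt G) (hF' : F'.IsCogeneratedAt G)
    {u : F.obj.obj G →ₗ[R] F'.obj.obj G}
    (hu : ∀ (x : G ⟶ G) v, u (F.obj.map x v) = F'.obj.map x (u v)) :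
    ∃ τ : F ⟶ F', ∀ v, τ.hom.app G v = u v := by
  have hex : ∀ K (z : F.obj.obj K), ∃ z' : F'.obj.obj K,
      ∀ y : K ⟶ G, F'.obj.map y z' = u (F.obj.map y z) := fun K z => by
    let N : Submodule R (F.obj.obj K) :=
      { carrier := {z | ∃ z', ∀ y : K ⟶ G, F'.obj.map y z' = u (F.obj.map y z)}
        zero_mem' := ⟨0, fun y => by simp only [_root_.map_zero]⟩
        add_mem' := by
          rintro a b ⟨a', ha⟩ ⟨b', hb⟩
          exact ⟨a' + b', fun y => by simp only [_root_.map_add, ha, hb]⟩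
        smul_mem' := by
          rintro r a ⟨a', ha⟩
          exact ⟨r • a', fun y => by simp only [_root_.map_smul, ha]⟩ }
    have hN : N = ⊤ := hF.eq_top fun x v => ⟨F'.obj.map x (u v), fun y => by
      rw [← F.map_comp_apply, ← F'.map_comp_apply, hu]⟩
    exact (hN ▸ Submodule.mem_top : z ∈ N)
  choose φ hφ using hex
  have huniq : ∀ {K} {z : F.obj.obj K} {z' : F'.obj.obj K},
      (∀ y : K ⟶ G, F'.obj.map y z' = u (F.obj.map y z)) → φ K z = z' := fun h =>
    sub_eq_zero.mp (hF'.eq_zero fun y => by rw [map_sub, hφ, h, sub_self])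
  let φₗ (K : C) : F.obj.obj K →ₗ[R] F'.obj.obj K :=
    { toFun := φ K
      map_add' := fun a b => huniq fun y => by simp only [_root_.map_add, hφ]
      map_smul' := fun r a => huniq fun y => by
        simp only [_root_.map_smul, hφ, RingHom.id_apply] }
  refine ⟨⟨{ app := fun K => ModuleCat.ofHom (φₗ K), naturality := fun K L f => ?_ }⟩, fun v => ?_⟩
  · ext z
    exact huniq fun y => by
      change F'.obj.map y (F'.obj.map f (φ K z)) = u (F.obj.map y (F.obj.map f z))
      rw [← F'.map_comp_apply, ← F.map_comp_apply, hφ]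
  · exact huniq fun y => (hu y v).symm

theorem nonempty_iso_of_equiv (hF : F.IsGeneratedAt G) (hF₀ : F.IsCogeneratedAt G)
    (hF' : F'.IsGeneratedAt G) (hF'₀ : F'.IsCogeneratedAt G) {u : F.obj.obj G ≃ₗ[R] F'.obj.obj G}
    (hu : ∀ (x : G ⟶ G) v, u (F.obj.map x v) = F'.obj.map x (u v)) : Nonempty (F ≅ F') := by
  obtain ⟨τ, hτ⟩ := exists_hom_app_eq hF hF'₀ (u := u.toLinearMap) hu
  have : IsIso τ := isIso_of_bijective τ fun K => by
    constructor
    · refine (injective_iff_map_eq_zero (τ.hom.app K).hom).mpr fun z hz => ?_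
      refine hF₀.eq_zero fun y => u.map_eq_zero_iff.mp ?_
      calc u (F.obj.map y z)
        _ = F'.obj.map y (τ.hom.app K z) := by rw [← naturality_apply, hτ]; rfl
        _ = 0 := (congrArg _ hz).trans (_root_.map_zero _)
    · refine LinearMap.range_eq_top.mp (hF'.eq_top fun x v => ?_)
      refine ⟨F.obj.map x (u.symm v), (naturality_apply τ x _).trans ?_⟩
      rw [hτ, LinearEquiv.coe_coe, u.apply_symm_apply]
  exact ⟨asIso τ⟩

end Intertwining

end LinearFunctor

end LinearFunctors

/-! ### The functors `S_{G,V}` -/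

section FunctorS

open LinearFunctor

variable {R : Type w} [CommRing R] {p : ℕ} [Fact p.Prime]

variable (G : BisetCat.{u, w} R p) {V : Type (max (u + 1) w)} [AddCommGroup V] [Module R V]
  (ρ : End G →ₐ[R] Module.End R V)

namespace functorS

/-- The map `V → S_{G,V}(K)` sending `v` to the class of `x ⊗ v`. -/
noncomputable def mk {K : BisetCat.{u, w} R p} (x : G ⟶ K) : V →ₗ[R] (functorS G ρ).obj.obj K :=
  (subJ G ρ K).mkQ ∘ₗ (balancedRel G ρ K).mkQ ∘ₗ TensorProduct.mk R (G ⟶ K) V x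

variable {G ρ} in
theorem mem_of_mk_mem {K : BisetCat.{u, w} R p} {N : Submodule R ((functorS G ρ).obj.obj K)}
    (h : ∀ (x : G ⟶ K) (v : V), mk G ρ x v ∈ N) (z : (functorS G ρ).obj.obj K) : z ∈ N := by
  obtain ⟨z, rfl⟩ := (subJ G ρ K).mkQ_surjective z
  obtain ⟨z, rfl⟩ := (balancedRel G ρ K).mkQ_surjective z
  let q : (G ⟶ K) ⊗[R] V →ₗ[R] (functorS G ρ).obj.obj K :=
    (subJ G ρ K).mkQ ∘ₗ (balancedRel G ρ K).mkQ
  change z ∈ N.comap q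
  induction z using TensorProduct.induction_on with
  | zero => exact Submodule.zero_mem _
  | tmul x v => exact h x v
  | add a b ha hb => exact Submodule.add_mem _ ha hb

theorem map_mk {K L : BisetCat.{u, w} R p} (x : G ⟶ K) (f : K ⟶ L) (v : V) :
    (functorS G ρ).obj.map f (mk G ρ x v) = mk G ρ (x ≫ f) v := rfl

theorem mk_comp {K : BisetCat.{u, w} R p} (e : G ⟶ G) (x : G ⟶ K) (v : V) :
    mk G ρ (e ≫ x) v = mk G ρ x (ρ e v) := by
  refine congrArg (subJ G ρ K).mkQ ((Submodule.Quotient.eq _).mpr ?_)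
  exact Submodule.subset_span ⟨x, e, v, rfl⟩

/-- The map `S_{G,V}(K) → V`, `x ⊗ v ↦ (y ∘ x) v`. -/
noncomputable def eval {K : BisetCat.{u, w} R p} (y : K ⟶ G) :
    (functorS G ρ).obj.obj K →ₗ[R] V :=
  (subJ G ρ K).liftQ (evalL G ρ y) (iInf_le _ y)

theorem eval_mk {K : BisetCat.{u, w} R p} (x : G ⟶ K) (y : K ⟶ G) (v : V) :
    eval G ρ y (mk G ρ x v) = ρ (x ≫ y : G ⟶ G) v := rfl

theorem mk_id_eval {K : BisetCat.{u, w} R p} (y : K ⟶ G) (z : (functorS G ρ).obj.obj K) :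
    mk G ρ (𝟙 G) (eval G ρ y z) = (functorS G ρ).obj.map y z := by
  refine mem_of_mk_mem
    (N := LinearMap.eqLocus (mk G ρ (𝟙 G) ∘ₗ eval G ρ y) ((functorS G ρ).obj.map y).hom)
    (fun x v => ?_) z
  change mk G ρ (𝟙 G) (eval G ρ y (mk G ρ x v)) = (functorS G ρ).obj.map y (mk G ρ x v)
  rw [eval_mk, ← mk_comp, Category.comp_id, map_mk]

/-- The isomorphism `V ≃ S_{G,V}(G)`, `v ↦ 1 ⊗ v`. -/
noncomputable def unitEquiv : V ≃ₗ[R] (functorS G ρ).obj.obj G :=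
  LinearEquiv.ofLinearMap (mk G ρ (𝟙 G)) (eval G ρ (𝟙 G))
    (LinearMap.ext fun z => by
      rw [LinearMap.comp_apply, mk_id_eval]
      exact map_id_apply _ z)
    (LinearMap.ext fun v => by
      rw [LinearMap.comp_apply, eval_mk, Category.comp_id]
      exact LinearMap.congr_fun (map_one ρ) v)

theorem map_unitEquiv {K : BisetCat.{u, w} R p} (x : G ⟶ K) (v : V) :
    (functorS G ρ).obj.map x (unitEquiv G ρ v) = mk G ρ x v := by
  refine (map_mk G ρ (𝟙 G) x v).trans ?_
  rw [Category.id_comp]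

theorem intertwines_unitEquiv : Intertwines (functorS G ρ) ρ (unitEquiv G ρ) := fun x v => by
  rw [map_unitEquiv, ← Category.comp_id x, mk_comp, Category.comp_id]
  rfl

theorem isGeneratedAt : IsGeneratedAt (functorS G ρ) G := fun _ =>
  Submodule.eq_top_iff'.mpr <| mem_of_mk_mem fun x v =>
    Submodule.mem_iSup_of_mem x ⟨unitEquiv G ρ v, map_unitEquiv G ρ x v⟩

theorem isCogeneratedAt : IsCogeneratedAt (functorS G ρ) G := fun K => by
  refine (Submodule.eq_bot_iff _).mpr fun z hz => ?_
  have heval : ∀ y : K ⟶ G, eval G ρ y z = 0 := fun y =>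
    (unitEquiv G ρ).map_eq_zero_iff.mp <|
      (mk_id_eval G ρ y z).trans ((Submodule.mem_iInf _).mp hz y)
  obtain ⟨z, rfl⟩ := (subJ G ρ K).mkQ_surjective z
  exact (Submodule.Quotient.mk_eq_zero _).mpr ((Submodule.mem_iInf _).mpr heval)

end functorS

variable {G ρ}

theorem simple_functorS (hρ : IsIrreducible ρ) : Simple (functorS G ρ) :=
  simple_of_isIrreducible_action (functorS.isGeneratedAt G ρ) (functorS.isCogeneratedAt G ρ)
    ((functorS.intertwines_unitEquiv G ρ).isIrreducible_action hρ)

theorem nonempty_iso_functorS [Nontrivial V] {F : BisetFunctor.{u, w} R p} [Simple F]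
    {u : V ≃ₗ[R] F.obj.obj G} (hu : Intertwines F ρ u) : Nonempty (F ≅ functorS G ρ) := by
  have : Nontrivial (F.obj.obj G) := u.symm.toEquiv.nontrivial
  refine nonempty_iso_of_equiv isGeneratedAt_of_simple isCogeneratedAt_of_simple
    (functorS.isGeneratedAt G ρ) (functorS.isCogeneratedAt G ρ)
    (u := u.symm ≪≫ₗ functorS.unitEquiv G ρ) fun x z => ?_
  obtain ⟨v, rfl⟩ := u.surjective z
  rw [hu]
  simp only [LinearEquiv.trans_apply, LinearEquiv.symm_apply_apply]
  exact (functorS.intertwines_unitEquiv G ρ x v).symm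

end FunctorS

/-! ### The classification -/

section Classification

open LinearFunctor

variable {R : Type w} [CommRing R] {p : ℕ} [Fact p.Prime] {G H : BisetCat.{u, w} R p}

section Inflate

variable {V : Type (max (u + 1) w)} [AddCommGroup V] [Module R V]
  [Module (MonoidAlgebra R (Out G.carrier)) V]
  [IsScalarTower R (MonoidAlgebra R (Out G.carrier)) V]

theorem inflate_apply (x : End G) (v : V) :
    inflate (essentialEquiv G) V x v = endToOut G x • v := rfl

theorem isIrreducible_inflate_iff :
    IsIrreducible (inflate (essentialEquiv G) V) ↔
      IsSimpleModule (MonoidAlgebra R (Out G.carrier)) V := by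
  constructor
  · rintro ⟨_, hW⟩
    refine { eq_bot_or_eq_top := fun W => ?_ }
    exact (hW (W.restrictScalars R) fun x v hv => W.smul_mem (endToOut G x) hv).imp
      (Submodule.restrictScalars_eq_bot_iff R _ _).mp
      (Submodule.restrictScalars_eq_top_iff R _ _).mp
  · intro hV
    refine ⟨IsSimpleModule.nontrivial (MonoidAlgebra R (Out G.carrier)) V, fun W hW => ?_⟩
    let W' : Submodule (MonoidAlgebra R (Out G.carrier)) V :=
      { W with smul_mem' := (endToOut_surjective G).forall.mpr hW }
    change W'.restrictScalars R = ⊥ ∨ W'.restrictScalars R = ⊤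
    rw [Submodule.restrictScalars_eq_bot_iff, Submodule.restrictScalars_eq_top_iff]
    exact eq_bot_or_eq_top W'

theorem exists_inflate_eq {M : Type (max (u + 1) w)} [AddCommGroup M] [Module R M]
    (ρ : End G →ₐ[R] Module.End R M) (hρ : ∀ x ∈ essentialIdeal G, ρ x = 0) :
    ∃ (_ : Module (MonoidAlgebra R (Out G.carrier)) M)
      (_ : IsScalarTower R (MonoidAlgebra R (Out G.carrier)) M),
      inflate (essentialEquiv G) M = ρ := by
  let α : MonoidAlgebra R (Out G.carrier) →ₐ[R] Module.End R M :=
    (Ideal.Quotient.liftₐ (essentialIdeal G) ρ hρ).comp (essentialEquiv G).symm.toAlgHom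
  let _ : Module (MonoidAlgebra R (Out G.carrier)) M := Module.compHom M α.toRingHom
  have hsmul (a : MonoidAlgebra R (Out G.carrier)) (v : M) : a • v = α a v := rfl
  refine ⟨inferInstance, ⟨fun r a v => by rw [hsmul, hsmul, _root_.map_smul]; rfl⟩, ?_⟩
  ext x v
  change Ideal.Quotient.liftₐ (essentialIdeal G) ρ hρ
    ((essentialEquiv G).symm (essentialEquiv G (Ideal.Quotient.mk _ x))) v = ρ x v
  rw [AlgEquiv.symm_apply_apply]
  rfl

end Inflate

theorem exists_action_eq_zero_of_simple (F : BisetFunctor.{u, w} R p) [Simple F] :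
    ∃ G : BisetCat.{u, w} R p, Nontrivial (F.obj.obj G) ∧
      ∀ x ∈ essentialIdeal G, action F G x = 0 := by
  obtain ⟨G, hG, hmin⟩ := exists_minimalFor_of_wellFoundedLT
    (fun G : BisetCat.{u, w} R p => Nontrivial (F.obj.obj G)) (fun G => Nat.card G.carrier)
    exists_nontrivial
  refine ⟨G, hG, ?_⟩
  have hle : BisetCat.factoring G G ≤ LinearMap.ker (action F G).toLinearMap := by
    refine BisetCat.factoring_le_iff.mpr fun K a b hK => ?_
    have : Subsingleton (F.obj.obj K) := by
      by_contra! hK'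
      exact hK.not_ge (hmin hK' hK.le)
    refine LinearMap.ext fun v => ?_
    calc F.obj.map (a ≫ b) v
      _ = F.obj.map b (F.obj.map a v) := map_comp_apply F a b v
      _ = 0 := by rw [Subsingleton.elim (F.obj.map a v) 0, map_zero]
  exact fun x hx => hle hx

theorem card_le_of_comp_notMem {x : G ⟶ H} {y : H ⟶ G} (h : x ≫ y ∉ BisetCat.factoring G G) :
    Nat.card G.carrier ≤ Nat.card H.carrier := by
  by_contra! hlt
  exact h (Submodule.subset_span ⟨H, x, y, hlt, rfl⟩)

theorem nonempty_mulEquiv_of_comp_notMem (hc : Nat.card H.carrier ≤ Nat.card G.carrier)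
    {x : G ⟶ H} {y : H ⟶ G} (h : x ≫ y ∉ BisetCat.factoring G G) :
    Nonempty (G.carrier ≃* H.carrier) := by
  by_contra hne
  have := not_nonempty_iff.mp hne
  have hx : x ∈ BisetCat.factoring G H :=
    BisetCat.factoring_eq_top_of_isEmpty hc ▸ Submodule.mem_top
  exact h (BisetCat.comp_mem_factoring hx y)

variable {V : Type (max (u + 1) w)} [AddCommGroup V] [Module R V]
  [Module (MonoidAlgebra R (Out G.carrier)) V]
  [IsScalarTower R (MonoidAlgebra R (Out G.carrier)) V]
  {W : Type (max (u + 1) w)} [AddCommGroup W] [Module R W]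
  [Module (MonoidAlgebra R (Out H.carrier)) W]
  [IsScalarTower R (MonoidAlgebra R (Out H.carrier)) W]

theorem exists_comp_notMem_factoring
    [Nontrivial ((functorS G (inflate (essentialEquiv G) V)).obj.obj H)] :
    ∃ (x : G ⟶ H) (y : H ⟶ G), x ≫ y ∉ BisetCat.factoring G G := by
  let ρ := inflate (essentialEquiv G) V
  obtain ⟨x, y, hxy⟩ := exists_map_comp_ne_zero
    (functorS.isGeneratedAt G ρ) (functorS.isCogeneratedAt G ρ) (K := H)
  refine ⟨x, y, fun h => hxy ((functorS.intertwines_unitEquiv G _).map_eq_zero ?_)⟩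
  ext v
  rw [inflate_apply, endToOut_eq_zero_iff.mpr h, zero_smul]
  rfl

theorem exists_iso_functorS (F : BisetFunctor.{u, w} R p) [Simple F] :
    ∃ (G : BisetCat.{u, w} R p) (V : Type (max (u + 1) w)) (_ : AddCommGroup V)
      (_ : Module R V) (_ : Module (MonoidAlgebra R (Out G.carrier)) V)
      (_ : IsScalarTower R (MonoidAlgebra R (Out G.carrier)) V),
      IsSimpleModule (MonoidAlgebra R (Out G.carrier)) V ∧
        Nonempty (F ≅ functorS G (inflate (essentialEquiv G) V)) := by
  obtain ⟨G, _, hG⟩ := exists_action_eq_zero_of_simple F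
  obtain ⟨_, _, hinfl⟩ := exists_inflate_eq (action F G) hG
  refine ⟨G, F.obj.obj G, inferInstance, inferInstance, inferInstance, inferInstance, ?_, ?_⟩
  · rw [← isIrreducible_inflate_iff, hinfl]
    exact isIrreducible_action_of_simple
  · rw [hinfl]
    exact nonempty_iso_functorS (u := LinearEquiv.refl R _) fun x v => rfl

theorem map_inflate_eq_iff {f : G.carrier ≃* H.carrier} {t : V ≃ₗ[R] W} :
    (∀ (x : G ⟶ G) v, t (inflate (essentialEquiv G) V x v) =
      inflate (essentialEquiv H) W
        ((BisetCat.isoOfMulEquiv f).inv ≫ x ≫ (BisetCat.isoOfMulEquiv f).hom : H ⟶ H) (t v)) ↔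
      ∀ (a : MonoidAlgebra R (Out G.carrier)) v,
        t (a • v) = MonoidAlgebra.domCongr R R (outCongr f) a • t v := by
  rw [(endToOut_surjective G).forall]
  refine forall₂_congr fun x v => ?_
  rw [← endToOut_conj]
  rfl

theorem nonempty_mulEquiv_of_iso [Nontrivial V] [Nontrivial W]
    (j : functorS G (inflate (essentialEquiv G) V) ≅ functorS H (inflate (essentialEquiv H) W)) :
    Nonempty (G.carrier ≃* H.carrier) := by
  have := (functorS.unitEquiv H (inflate (essentialEquiv H) W)).symm.toEquiv.nontrivial
  have := (functorS.unitEquiv G (inflate (essentialEquiv G) V)).symm.toEquiv.nontrivial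
  have : Nontrivial ((functorS G (inflate (essentialEquiv G) V)).obj.obj H) :=
    (Equiv.ofBijective _ (bijective_of_isIso j.hom H)).nontrivial
  have : Nontrivial ((functorS H (inflate (essentialEquiv H) W)).obj.obj G) :=
    (Equiv.ofBijective _ (bijective_of_isIso j.inv G)).nontrivial
  obtain ⟨_, _, hGHG⟩ := exists_comp_notMem_factoring (G := G) (H := H) (V := V)
  obtain ⟨_, _, hHGH⟩ := exists_comp_notMem_factoring (G := H) (H := G) (V := W)
  exact nonempty_mulEquiv_of_comp_notMem (card_le_of_comp_notMem hHGH) hGHG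

theorem exists_equiv_of_iso [Nontrivial V] [Nontrivial W]
    (j : functorS G (inflate (essentialEquiv G) V) ≅ functorS H (inflate (essentialEquiv H) W)) :
    ∃ (f : G.carrier ≃* H.carrier) (t : V ≃ₗ[R] W),
      ∀ (a : MonoidAlgebra R (Out G.carrier)) (v : V),
        t (a • v) = MonoidAlgebra.domCongr R R (outCongr f) a • t v := by
  obtain ⟨f⟩ := nonempty_mulEquiv_of_iso j
  obtain ⟨t, ht⟩ := ((functorS.intertwines_unitEquiv G _).trans_iso j).exists_equiv
    (BisetCat.isoOfMulEquiv f) (functorS.intertwines_unitEquiv H _)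
  exact ⟨f, t, map_inflate_eq_iff.mp ht⟩

theorem nonempty_iso_of_equiv [IsSimpleModule (MonoidAlgebra R (Out G.carrier)) V]
    (f : G.carrier ≃* H.carrier) (t : V ≃ₗ[R] W)
    (ht : ∀ (a : MonoidAlgebra R (Out G.carrier)) (v : V),
      t (a • v) = MonoidAlgebra.domCongr R R (outCongr f) a • t v) :
    Nonempty (functorS G (inflate (essentialEquiv G) V) ≅
      functorS H (inflate (essentialEquiv H) W)) := by
  have := IsSimpleModule.nontrivial (MonoidAlgebra R (Out G.carrier)) V
  have : Nontrivial W := t.symm.toEquiv.nontrivial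
  have := simple_functorS (isIrreducible_inflate_iff.mpr ‹IsSimpleModule _ V›)
  exact nonempty_iso_functorS <| (functorS.intertwines_unitEquiv G _).trans_mapIso
    (BisetCat.isoOfMulEquiv f) (map_inflate_eq_iff.mpr ht)

end Classification

end PBifree

theorem mainTheorem11 (R : Type w) [CommRing R] (p : ℕ) [Fact p.Prime] :
    -- the essential algebra of `G` is `R Out(G)`, the class of the biset `G` twisted by an
    -- automorphism `a` corresponding to the class of `a` in `Out(G)`
    ∃ e : ∀ G : PBifree.BisetCat.{u, w} R p,
        PBifree.EssentialAlgebra G ≃ₐ[R] MonoidAlgebra R (PBifree.Out G.carrier),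
      (∀ (G : PBifree.BisetCat.{u, w} R p) (a : MulAut G.carrier),
        e G (Ideal.Quotient.mk (PBifree.essentialIdeal G)
            (PBifree.BisetCat.homOfBiset (PBifree.Biset.ofIso p a))) =
          MonoidAlgebra.single (QuotientGroup.mk a) 1) ∧
      -- every `S_{G,V}` with `V` simple is simple
      (∀ (G : PBifree.BisetCat.{u, w} R p) (V : Type (max (u + 1) w)) [AddCommGroup V] [Module R V]
        [Module (MonoidAlgebra R (PBifree.Out G.carrier)) V]
        [IsScalarTower R (MonoidAlgebra R (PBifree.Out G.carrier)) V],
        IsSimpleModule (MonoidAlgebra R (PBifree.Out G.carrier)) V →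
          Simple (PBifree.functorS G (PBifree.inflate (e G) V))) ∧
      -- every simple functor is isomorphic to some `S_{G,V}` with `V` simple
      (∀ F : PBifree.BisetFunctor.{u, w} R p, Simple F →
        ∃ (G : PBifree.BisetCat.{u, w} R p) (V : Type (max (u + 1) w)) (_ : AddCommGroup V)
          (_ : Module R V) (_ : Module (MonoidAlgebra R (PBifree.Out G.carrier)) V)
          (_ : IsScalarTower R (MonoidAlgebra R (PBifree.Out G.carrier)) V),
          IsSimpleModule (MonoidAlgebra R (PBifree.Out G.carrier)) V ∧
            Nonempty (F ≅ PBifree.functorS G (PBifree.inflate (e G) V))) ∧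
      -- `S_{G,V} ≅ S_{H,W}` if and only if the pairs `(G, V)` and `(H, W)` are isomorphic
      (∀ (G H : PBifree.BisetCat.{u, w} R p)
        (V : Type (max (u + 1) w)) [AddCommGroup V] [Module R V]
        [Module (MonoidAlgebra R (PBifree.Out G.carrier)) V]
        [IsScalarTower R (MonoidAlgebra R (PBifree.Out G.carrier)) V]
        (W : Type (max (u + 1) w)) [AddCommGroup W] [Module R W]
        [Module (MonoidAlgebra R (PBifree.Out H.carrier)) W]
        [IsScalarTower R (MonoidAlgebra R (PBifree.Out H.carrier)) W],
        IsSimpleModule (MonoidAlgebra R (PBifree.Out G.carrier)) V →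
        IsSimpleModule (MonoidAlgebra R (PBifree.Out H.carrier)) W →
          (Nonempty (PBifree.functorS G (PBifree.inflate (e G) V) ≅
              PBifree.functorS H (PBifree.inflate (e H) W)) ↔
            ∃ (f : G.carrier ≃* H.carrier) (t : V ≃ₗ[R] W),
              ∀ (a : MonoidAlgebra R (PBifree.Out G.carrier)) (v : V),
                t (a • v) = MonoidAlgebra.domCongr R R (PBifree.outCongr f) a • t v)) := by
  refine ⟨PBifree.essentialEquiv, PBifree.essentialEquiv_homOfIso, ?_, ?_, ?_⟩
  · intro G V _ _ _ _ hV
    exact PBifree.simple_functorS (PBifree.isIrreducible_inflate_iff.mpr hV)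
  · intro F hF
    exact PBifree.exists_iso_functorS F
  · intro G H V _ _ _ _ W _ _ _ _ hV hW
    have := IsSimpleModule.nontrivial (MonoidAlgebra R (PBifree.Out G.carrier)) V
    have := IsSimpleModule.nontrivial (MonoidAlgebra R (PBifree.Out H.carrier)) W
    exact ⟨fun ⟨j⟩ => PBifree.exists_equiv_of_iso j,
      fun ⟨f, t, ht⟩ => PBifree.nonempty_iso_of_equiv f t ht⟩
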